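/- Let $\mu$ be a Borel measure on $\mathbb R$ with $\mu(\mathbb R)=\infty$ and $\int_{\mathbb R}\frac{d\mu(\lambda)}{1+\lambda^2}=1$, and let $\varkappa\in\mathbb C$, $|\varkappa|<1$. In $L^2(\mathbb R;d\mu)$ let $\mathcal B$ be the self-adjoint operator of multiplication by $\lambda$ on $\mathrm{Dom}(\mathcal B)=\{f:\int\lambda^2|f(\lambda)|^2d\mu(\lambda)<\infty\}$, let $\dot{\mathcal B}$ be its restriction to $\{f\in\mathrm{Dom}(\mathcal B):\int f\,d\mu=0\}$, and let $\widehat{\mathcal B}$ be the restriction of $(\dot{\mathcal B})^*$ to $\mathrm{Dom}(\dot{\mathcal B})\dot+\mathrm{span}\{\frac1{\lambda-i}-\varkappa\frac1{\lambda+i}\}$; $\mathfrak B=(\dot{\mathcal B},\widehat{\mathcal B},\mathcal B)$ is the model triple. Definitions. A triple $\mathfrak A=(\dot A,\widehat A,A)$ is regular if $\dot A$ is a densely defined symmetric operator with deficiency indices $(1,1)$, $\widehat A\neq\widehat A^*$ is a maximal dissipative extension of $\dot A$ and $A$ is a self-adjoint extension of $\dot A$. An extension $\widehat A$ of $\dot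 A$ is quasi-self-adjoint if $\dot A\subset\widehat A\subset(\dot A)^*$ and $\dot A=\widehat A|_{\mathrm{Dom}(\widehat A)\cap\mathrm{Dom}(\widehat A^*)}$. Choose $g_\pm\in\mathrm{Ker}((\dot A)^*\mp iI)$ with $\|g_\pm\|=1$ and $g_+-g_-\in\mathrm{Dom}(A)$. For $z\in\mathbb C_+$ the Weyl–Titchmarsh and Livšic functions of $(\dot A,A)$ are $$M_{(\dot A,A)}(z)=\big((zA+I)(A-zI)^{-1}g_+,g_+\big),\qquad s_{(\dot A,A)}(z)=\frac{z-i}{z+i}\cdot\frac{(g_z,g_-)}{(g_z,g_+)},\quad 0\ne g_z\in\mathrm{Ker}((\dot A)^*-zI);$$ the von Neumann parameter of $\mathfrak A$ is the number $k$, $|k|<1$, with $g_+-kg_-\in\mathrm{Dom}(\widehat A)$; and the characteristic function of $\mathfrak A$ is $S_{\mathfrak A}(z)=\frac{s(z)-k}{\overline k\,s(z)-1}$ with $s=s_{(\dot A,A)}$. These do not depend on the choices made. Theorem. Assume that $0$ belongs to the core of the spectrum of $\dot{\mathcal B}$, in the sense that $$\int_{\mathbb R}\frac{d\mu(\lambda)}{\lambda^2}=\infty\quad\text{and}\quad\mu(\{0\})=0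 .$$ Then $\dot{\mathcal B}$, $\widehat{\mathcal B}$, $\mathcal B$ are injective and (i) $(\dot{\mathcal B})^{-1}$ is a densely defined symmetric operator with deficiency indices $(1,1)$; (ii) $\mathcal B^{-1}$ is a self-adjoint extension of $(\dot{\mathcal B})^{-1}$; (iii) $(\widehat{\mathcal B})^{-1}$ is a quasi-self-adjoint extension of $(\dot{\mathcal B})^{-1}$. In particular the triple $\mathfrak C=(-(\dot{\mathcal B})^{-1},-(\widehat{\mathcal B})^{-1},-\mathcal B^{-1})$ is well defined and regular. Moreover, (iv) the von Neumann parameters of $\mathfrak B$ and $\mathfrak C$ coincide (both equal $\varkappa$); and the Livšic, Weyl–Titchmarsh and characteristic functions below are well defined and satisfy, for all $z\in\mathbb C_+$, (v) $s_{(-(\dot{\mathcal B})^{-1},-\mathcal B^{-1})}(-1/z)=s_{(\dot{\mathcal B},\mathcal B)}(z)$; (vi) $M_{(-(\dot{\mathcal B})^{-1},-\mathcal B^{-1})}(-1/z)=M_{(\dot{\mathcal B},\mathcal B)}(z)$; (vii) $S_{\mathfrak C}(-1/z)=S_{\mathfrak B}(z)$. -/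

import Mathlib

open MeasureTheory
open scoped ENNReal

noncomputable section

namespace TripleModel

section Abstract

variable {H : Type*} [NormedAddCommGroup H] [InnerProductSpace ℂ H]

/-- Densely defined symmetric operator. -/
def IsSymmetricOp (T : H →ₗ.[ℂ] H) : Prop :=
  Dense (T.domain : Set H) ∧ T.IsFormalAdjoint T

/-- `Im (T f, f) ≥ 0` on the domain (the form `(f, g)` linear in `f` is `inner ℂ g f`). -/
def IsDissipative (T : H →ₗ.[ℂ] H) : Prop :=
  ∀ f : T.domain, 0 ≤ (inner ℂ (f : H) (T f)).im

/-- Dissipative, without proper dissipative extensions. -/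
def IsMaximalDissipative (T : H →ₗ.[ℂ] H) : Prop :=
  IsDissipative T ∧ ∀ S : H →ₗ.[ℂ] H, IsDissipative S → T ≤ S → S = T

variable [CompleteSpace H]

/-- The defect subspace `Ker (T* - z I)`. -/
def defectSpace (T : H →ₗ.[ℂ] H) (z : ℂ) : Submodule ℂ H where
  carrier := {g | ∃ h : g ∈ T.adjoint.domain, T.adjoint ⟨g, h⟩ = z • g}
  zero_mem' := ⟨T.adjoint.domain.zero_mem, by
    rw [smul_zero]; exact T.adjoint.map_zero⟩
  add_mem' := by
    rintro a b ⟨ha, ea⟩ ⟨hb, eb⟩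
    refine ⟨T.adjoint.domain.add_mem ha hb, ?_⟩
    have := T.adjoint.map_add ⟨a, ha⟩ ⟨b, hb⟩
    rw [ea, eb] at this
    rw [smul_add]
    exact this
  smul_mem' := by
    rintro c a ⟨ha, ea⟩
    refine ⟨T.adjoint.domain.smul_mem c ha, ?_⟩
    have := T.adjoint.map_smul c ⟨a, ha⟩
    rw [ea] at this
    rw [smul_comm]
    exact this

/-- `dim Ker (T* - iI) = m` and `dim Ker (T* + iI) = n`. -/
def HasDeficiencyIndices (T : H →ₗ.[ℂ] H) (m n : Cardinal) : Prop :=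
  Module.rank ℂ (defectSpace T Complex.I) = m ∧ Module.rank ℂ (defectSpace T (-Complex.I)) = n

/-- `A` is a self-adjoint extension of `A₀`. -/
def IsSelfAdjointExtension (A₀ A : H →ₗ.[ℂ] H) : Prop :=
  A₀ ≤ A ∧ IsSelfAdjoint A

/-- `A₀ ⊂ Â ⊂ A₀*` and `A₀` is the restriction of `Â` to `Dom Â ∩ Dom Â*`. -/
def IsQuasiSelfAdjointExtension (A₀ Ahat : H →ₗ.[ℂ] H) : Prop :=
  A₀ ≤ Ahat ∧ Ahat ≤ A₀.adjoint ∧ Ahat.domRestrict Ahat.adjoint.domain = A₀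

/-- Normalized deficiency elements `g₊ ∈ Ker (A₀* - iI)`, `g₋ ∈ Ker (A₀* + iI)` such that
`g₊ - g₋ ∈ Dom A`. -/
structure IsDeficiencyPair (A₀ A : H →ₗ.[ℂ] H) (gp gm : H) : Prop where
  mem_plus : gp ∈ defectSpace A₀ Complex.I
  mem_minus : gm ∈ defectSpace A₀ (-Complex.I)
  norm_plus : ‖gp‖ = 1
  norm_minus : ‖gm‖ = 1
  sub_mem : gp - gm ∈ A.domain

/-- `s` is, on the upper half-plane, the Livšic function of the pair `(A₀, A)`:
`s z = (z - i) / (z + i) * (g_z, g₋) / (g_z, g₊)` for `0 ≠ g_z ∈ Ker (A₀* - zI)`.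
All the choices that enter exist, the denominators do not vanish, and the value is the same
for every choice; hence `s` is determined on the upper half-plane. -/
structure IsLivsicFunction (A₀ A : H →ₗ.[ℂ] H) (s : ℂ → ℂ) : Prop where
  exists_pair : ∃ gp gm, IsDeficiencyPair A₀ A gp gm
  exists_defect : ∀ z : ℂ, 0 < z.im → ∃ g ∈ defectSpace A₀ z, g ≠ 0
  formula : ∀ gp gm, IsDeficiencyPair A₀ A gp gm → ∀ z : ℂ, 0 < z.im →
    ∀ g ∈ defectSpace A₀ z, g ≠ 0 →
      inner ℂ gp g ≠ 0 ∧
      s z = (z - Complex.I) / (z + Complex.I) * (inner ℂ gm g / inner ℂ gp g)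

/-- `M` is, on the upper half-plane, the Weyl–Titchmarsh function of the pair `(A₀, A)`:
`M z = ((z A + I) (A - z I)⁻¹ g₊, g₊)`. Here `f = (A - z I)⁻¹ g₊`; the choices exist and the value
does not depend on them. -/
structure IsWeylTitchmarshFunction (A₀ A : H →ₗ.[ℂ] H) (M : ℂ → ℂ) : Prop where
  exists_pair : ∃ gp gm, IsDeficiencyPair A₀ A gp gm
  bijective : ∀ z : ℂ, 0 < z.im → Function.Bijective fun f : A.domain => A f - z • (f : H)
  formula : ∀ gp gm, IsDeficiencyPair A₀ A gp gm → ∀ z : ℂ, 0 < z.im →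
    ∀ f : A.domain, A f - z • (f : H) = gp → M z = inner ℂ gp (z • A f + (f : H))

/-- Three operators in one Hilbert space. -/
structure OperatorTriple (H : Type*) [NormedAddCommGroup H] [InnerProductSpace ℂ H] where
  /-- the symmetric operator -/
  symm : H →ₗ.[ℂ] H
  /-- its dissipative extension -/
  diss : H →ₗ.[ℂ] H
  /-- its reference self-adjoint extension -/
  ref : H →ₗ.[ℂ] H

/-- Regular triples: a densely defined symmetric operator with deficiency indices `(1, 1)`,
a maximal dissipative, non-self-adjoint extension of it, and a self-adjoint extension of it. -/
structure OperatorTriple.IsRegular (𝔄 : OperatorTriple H) : Prop where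
  symmetric : IsSymmetricOp 𝔄.symm
  indices : HasDeficiencyIndices 𝔄.symm 1 1
  le_diss : 𝔄.symm ≤ 𝔄.diss
  maximalDissipative : IsMaximalDissipative 𝔄.diss
  not_selfAdjoint : ¬ IsSelfAdjoint 𝔄.diss
  selfAdjointExtension : IsSelfAdjointExtension 𝔄.symm 𝔄.ref

/-- `k` is the von Neumann parameter of the triple: `|k| < 1` and `g₊ - k g₋ ∈ Dom Â`
(admissible pairs `g₊, g₋` exist, and the membership holds for each of them). -/
structure OperatorTriple.IsVonNeumannParameter (𝔄 : OperatorTriple H) (k : ℂ) : Prop where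
  norm_lt_one : ‖k‖ < 1
  exists_pair : ∃ gp gm, IsDeficiencyPair 𝔄.symm 𝔄.ref gp gm
  mem_domain : ∀ gp gm, IsDeficiencyPair 𝔄.symm 𝔄.ref gp gm → gp - k • gm ∈ 𝔄.diss.domain

/-- `S` is, on the upper half-plane, the characteristic function of the triple:
`S z = (s z - k) / (conj k * s z - 1)` with the Livšic function `s` of `(Ȧ, A)` and the
von Neumann parameter `k`. -/
def OperatorTriple.IsCharacteristicFunction (𝔄 : OperatorTriple H) (S : ℂ → ℂ) : Prop :=
  ∃ (s : ℂ → ℂ) (k : ℂ), IsLivsicFunction 𝔄.symm 𝔄.ref s ∧ 𝔄.IsVonNeumannParameter k ∧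
    ∀ z : ℂ, 0 < z.im → starRingEnd ℂ k * s z - 1 ≠ 0 ∧
      S z = (s z - k) / (starRingEnd ℂ k * s z - 1)

/-- The triple `(-Ȧ⁻¹, -Â⁻¹, -A⁻¹)`; meaningful if the three operators are injective. -/
def OperatorTriple.negInverse (𝔄 : OperatorTriple H) : OperatorTriple H where
  symm := -𝔄.symm.inverse
  diss := -𝔄.diss.inverse
  ref := -𝔄.ref.inverse

end Abstract

section Model

/-- The self-adjoint operator of multiplication by the independent variable in `L²(ℝ; dμ)`, on
`{f | ∫ t² |f t|² dμ(t) < ∞}`. -/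
def mulOp (μ : Measure ℝ) : Lp ℂ 2 μ →ₗ.[ℂ] Lp ℂ 2 μ where
  domain :=
    { carrier := {f | MemLp (fun t : ℝ => (t : ℂ) * f t) 2 μ}
      zero_mem' := by
        refine (memLp_congr_ae ?_).mpr (MemLp.zero (p := 2) (μ := μ) (ε := ℂ))
        filter_upwards [Lp.coeFn_zero ℂ 2 μ] with t ht
        simp only [ht, Pi.zero_apply, mul_zero]
      add_mem' := by
        intro f g hf hg
        refine (memLp_congr_ae ?_).mpr (MemLp.add hf hg)
        filter_upwards [Lp.coeFn_add f g] with t ht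
        simp only [ht, Pi.add_apply, mul_add]
      smul_mem' := by
        intro c f hf
        refine (memLp_congr_ae ?_).mpr (MemLp.const_smul hf c)
        filter_upwards [Lp.coeFn_smul c f] with t ht
        simp [ht, mul_left_comm] }
  toFun :=
    { toFun := fun f => MemLp.toLp (fun t : ℝ => (t : ℂ) * (f : Lp ℂ 2 μ) t) f.2
      map_add' := by
        rintro ⟨f, hf⟩ ⟨g, hg⟩
        rw [← MemLp.toLp_add]
        refine MemLp.toLp_congr _ _ ?_
        filter_upwards [Lp.coeFn_add f g] with t ht
        change (t : ℂ) * (f + g : Lp ℂ 2 μ) t = (t : ℂ) * f t + (t : ℂ) * g t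
        rw [ht, Pi.add_apply, mul_add]
      map_smul' := by
        rintro c ⟨f, hf⟩
        rw [RingHom.id_apply, ← MemLp.toLp_const_smul]
        refine MemLp.toLp_congr _ _ ?_
        filter_upwards [Lp.coeFn_smul c f] with t ht
        simp [ht, mul_left_comm] }

/-- The elements of `L²(ℝ; dμ)` with `∫ f dμ = 0`. (If `∫ dμ(t) / (1 + t²) < ∞`, every `f` in the
domain of the multiplication operator is integrable.) -/
def zeroMean (μ : Measure ℝ) : Submodule ℂ (Lp ℂ 2 μ) where
  carrier := {f | Integrable f μ ∧ ∫ t, f t ∂μ = 0}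
  zero_mem' := by
    have h := Lp.coeFn_zero ℂ 2 μ
    refine ⟨(integrable_congr h).mpr (integrable_zero _ _ _), ?_⟩
    rw [integral_congr_ae h]
    simp
  add_mem' := by
    rintro f g ⟨hf, ef⟩ ⟨hg, eg⟩
    have h := Lp.coeFn_add f g
    refine ⟨(integrable_congr h).mpr (hf.add hg), ?_⟩
    rw [integral_congr_ae h]
    simp [integral_add hf hg, ef, eg]
  smul_mem' := by
    rintro c f ⟨hf, ef⟩
    have h := Lp.coeFn_smul c f
    refine ⟨(integrable_congr h).mpr (hf.smul c), ?_⟩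
    rw [integral_congr_ae h]
    simp [integral_const_mul, ef]

/-- The symmetric restriction of the multiplication operator to `{f ∈ Dom | ∫ f dμ = 0}`. -/
def symmOp (μ : Measure ℝ) : Lp ℂ 2 μ →ₗ.[ℂ] Lp ℂ 2 μ :=
  (mulOp μ).domRestrict (zeroMean μ)

/-- The line spanned by the class of `1 / (t - i) - κ / (t + i)`. -/
def extensionLine (μ : Measure ℝ) (κ : ℂ) : Submodule ℂ (Lp ℂ 2 μ) :=
  Submodule.span ℂ {f | (f : ℝ → ℂ) =ᵐ[μ]
    fun t => 1 / ((t : ℂ) - Complex.I) - κ * (1 / ((t : ℂ) + Complex.I))}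

/-- The quasi-self-adjoint extension of `symmOp μ`: the restriction of `(symmOp μ)*` to
`Dom (symmOp μ) + span {1 / (t - i) - κ / (t + i)}`. -/
def dissOp (μ : Measure ℝ) (κ : ℂ) : Lp ℂ 2 μ →ₗ.[ℂ] Lp ℂ 2 μ :=
  (symmOp μ).adjoint.domRestrict ((symmOp μ).domain ⊔ extensionLine μ κ)

/-- The model triple in `L²(ℝ; dμ)`. -/
def modelTriple (μ : Measure ℝ) (κ : ℂ) : OperatorTriple (Lp ℂ 2 μ) where
  symm := symmOp μ
  diss := dissOp μ κ
  ref := mulOp μ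

/-- The core of the spectrum of the model symmetric operator:
the real `s` with `∫ dμ(t) / (t - s)² = ∞` and `μ {s} = 0`. -/
def coreSpectrum (μ : Measure ℝ) : Set ℝ :=
  {s | ∫⁻ t, ENNReal.ofReal (1 / (t - s) ^ 2) ∂μ = ∞ ∧ μ {s} = 0}

end Model

end TripleModel

end

open TripleModel

open MeasureTheory
open scoped ENNReal

noncomputable section

namespace TripleModel

/-! ### Inverses, negatives and adjoints of operators through their graphs. -/

section Graph

variable {H : Type*} [NormedAddCommGroup H] [InnerProductSpace ℂ H]

/-! Write `A₀`, `X`, `A` for the symmetric, dissipative and self-adjoint operators of the model.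
Passing from `T` to `-T⁻¹` turns a graph point `(x, y)` into `(y, -x)`, and taking adjoints commutes
with this (`adjoint_inverse`, `adjoint_neg`). Since `A₀ ⊂ X, A ⊂ A₀*`, everything needed for the
transfer follows once `A₀*` is injective, and only that uses the hypothesis on the core of the
spectrum. Indeed, `A₀* u = 0` forces `t u(t) = c` for a constant `c`: a nonzero `c` would put `1/t`
into `L²`, contradicting the divergent integral, while `c = 0` leaves only the point `0`, which is
null (`ker_adjoint_symmOp`).

The map `z ↦ -1/z` fixes `i` and `-i`, so `-A₀⁻¹` has the same deficiency spaces as `A₀`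
(`defectSpace_neg_inverse`). However, `A₀* (g₊ + g₋) = i (g₊ - g₋)`, so `g₊ - g₋` lies in `Ran A`
exactly when `g₊ + g₋` lies in `Dom A`: admissible pairs correspond by `g₋ ↦ -g₋`
(`isDeficiencyPair_iff`). The same computation with `g₊ - κ g₋` shows that the von Neumann parameter
is preserved. In the Livšic function the sign of `g₋` cancels the sign that `(z - i)/(z + i)`
acquires under `z ↦ -1/z`; the Weyl–Titchmarsh function is carried over by a substitution in the
resolvent equation.

The facts about the model itself are derived from a few properties of the vectors `g z = 1/(t - z)`,
collected in `IsDefectModel`: deficiency indices, self-adjointness, maximal dissipativity, and the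
identity `s = (M - i)/(M + i)`. As `Im M ≥ 0`, this gives `|s| ≤ 1`, which makes the characteristic
function well defined. -/

lemma mem_graph_neg {T : H →ₗ.[ℂ] H} {x y : H} : (x, y) ∈ (-T).graph ↔ (x, -y) ∈ T.graph := by
  simp only [LinearPMap.mem_graph_iff]
  constructor
  · rintro ⟨u, rfl, hu⟩
    exact ⟨u, rfl, by rw [← hu, LinearPMap.neg_apply, neg_neg]⟩
  · rintro ⟨u, rfl, hu⟩
    exact ⟨u, rfl, by rw [LinearPMap.neg_apply, hu, neg_neg]⟩

lemma mem_graph_domRestrict {T : H →ₗ.[ℂ] H} {S : Submodule ℂ H} {x y : H} :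
    (x, y) ∈ (T.domRestrict S).graph ↔ x ∈ S ∧ (x, y) ∈ T.graph := by
  simp only [LinearPMap.mem_graph_iff]
  constructor
  · rintro ⟨u, rfl, hu⟩
    exact ⟨u.2.1, ⟨u, u.2.2⟩, rfl, by rw [← hu]; exact (LinearPMap.domRestrict_apply rfl).symm⟩
  · rintro ⟨hx, u, rfl, hu⟩
    exact ⟨⟨u, hx, u.2⟩, rfl, by rw [← hu]; exact LinearPMap.domRestrict_apply rfl⟩

lemma ker_eq_bot_iff {T : H →ₗ.[ℂ] H} :
    LinearMap.ker T.toFun = ⊥ ↔ ∀ x, (x, (0 : H)) ∈ T.graph → x = 0 := by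
  rw [LinearMap.ker_eq_bot']
  constructor
  · intro h x hx
    obtain ⟨u, rfl, hu⟩ := (LinearPMap.mem_graph_iff _).1 hx
    simp [h u hu]
  · intro h u hu
    exact Subtype.ext (h u ((LinearPMap.mem_graph_iff _).2 ⟨u, rfl, hu⟩))

lemma mem_graph_inverse {T : H →ₗ.[ℂ] H} (hT : LinearMap.ker T.toFun = ⊥) {x y : H} :
    (x, y) ∈ T.inverse.graph ↔ (y, x) ∈ T.graph := by
  rw [LinearPMap.inverse_graph hT, Submodule.mem_map]
  constructor
  · rintro ⟨⟨a, b⟩, hab, h⟩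
    simp only [LinearEquiv.coe_coe, LinearEquiv.prodComm_apply, Prod.swap_prod_mk,
      Prod.mk.injEq] at h
    obtain ⟨rfl, rfl⟩ := h
    exact hab
  · intro h
    exact ⟨(y, x), h, rfl⟩

lemma mem_graph_neg_inverse {T : H →ₗ.[ℂ] H} (hT : LinearMap.ker T.toFun = ⊥) {x y : H} :
    (x, y) ∈ (-T.inverse).graph ↔ (-y, x) ∈ T.graph := by
  rw [mem_graph_neg, mem_graph_inverse hT]

lemma ker_eq_bot_of_le {S T : H →ₗ.[ℂ] H} (h : S ≤ T) (hT : LinearMap.ker T.toFun = ⊥) :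
    LinearMap.ker S.toFun = ⊥ := by
  rw [ker_eq_bot_iff] at *
  exact fun x hx => hT x (LinearPMap.le_graph_of_le h hx)

lemma isFormalAdjoint_iff {S T : H →ₗ.[ℂ] H} :
    S.IsFormalAdjoint T ↔ ∀ a b c d, (a, b) ∈ S.graph → (c, d) ∈ T.graph →
      inner ℂ b c = inner ℂ a d := by
  constructor
  · intro h a b c d hab hcd
    obtain ⟨u, rfl, rfl⟩ := (LinearPMap.mem_graph_iff _).1 hab
    obtain ⟨v, rfl, rfl⟩ := (LinearPMap.mem_graph_iff _).1 hcd
    exact h u v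
  · intro h u v
    exact h _ _ _ _ (S.mem_graph u) (T.mem_graph v)

lemma isDissipative_iff {T : H →ₗ.[ℂ] H} :
    IsDissipative T ↔ ∀ a b, (a, b) ∈ T.graph → 0 ≤ (inner ℂ a b).im := by
  constructor
  · intro h a b hab
    obtain ⟨u, rfl, rfl⟩ := (LinearPMap.mem_graph_iff _).1 hab
    exact h u
  · intro h u
    exact h _ _ (T.mem_graph u)

lemma inverse_mono {S T : H →ₗ.[ℂ] H} (h : S ≤ T) (hT : LinearMap.ker T.toFun = ⊥) :
    S.inverse ≤ T.inverse := by
  refine LinearPMap.le_of_le_graph ?_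
  rintro ⟨x, y⟩ hxy
  rw [mem_graph_inverse (ker_eq_bot_of_le h hT)] at hxy
  exact (mem_graph_inverse hT).2 (LinearPMap.le_graph_of_le h hxy)

lemma neg_mono {S T : H →ₗ.[ℂ] H} (h : S ≤ T) : -S ≤ -T := by
  refine LinearPMap.le_of_le_graph ?_
  rintro ⟨x, y⟩ hxy
  rw [mem_graph_neg] at hxy ⊢
  exact LinearPMap.le_graph_of_le h hxy

/-- A dissipative operator `T` with `Ran (T + iI) = H` is maximal dissipative. -/
lemma isMaximalDissipative_of_surjective {T : H →ₗ.[ℂ] H} (hT : IsDissipative T)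
    (hsurj : ∀ h, ∃ a b, (a, b) ∈ T.graph ∧ b + Complex.I • a = h) : IsMaximalDissipative T := by
  refine ⟨hT, fun S hS hTS => le_antisymm (LinearPMap.le_of_le_graph ?_) hTS⟩
  rintro ⟨x, y⟩ hxy
  obtain ⟨a, b, hab, e⟩ := hsurj (y + Complex.I • x)
  have hab' := LinearPMap.le_graph_of_le hTS hab
  -- On the difference `d = x - a` the operator `S` acts as `-i`, so the form has imaginary part
  -- `-‖d‖²`, and dissipativity forces `d = 0`.
  have hsub : (x - a, y - b) ∈ S.graph := S.graph.sub_mem hxy hab'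
  have hy : y - b = -(Complex.I • (x - a)) := by
    rw [smul_sub, neg_sub, sub_eq_sub_iff_add_eq_add, ← e, add_comm]
  have him := (isDissipative_iff.1 hS) _ _ hsub
  rw [hy, inner_neg_right, inner_smul_right, Complex.neg_im, Complex.I_mul_im] at him
  have hn : (inner ℂ (x - a) (x - a)).re = ‖x - a‖ ^ 2 := inner_self_eq_norm_sq (𝕜 := ℂ) _
  have h0 : x - a = 0 := norm_eq_zero.1 (by nlinarith [norm_nonneg (x - a)])
  have hxa : x = a := sub_eq_zero.1 h0
  have hyb : y = b := by
    rw [h0, smul_zero, neg_zero] at hy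
    exact sub_eq_zero.1 hy
  rw [hxa, hyb]
  exact hab

lemma IsDissipative.neg_inverse {T : H →ₗ.[ℂ] H} (hT : IsDissipative T)
    (hker : LinearMap.ker T.toFun = ⊥) : IsDissipative (-T.inverse) := by
  rw [isDissipative_iff] at *
  intro a b hab
  rw [mem_graph_neg_inverse hker] at hab
  have := hT _ _ hab
  rw [inner_neg_left, Complex.neg_im] at this
  rwa [← inner_conj_symm, Complex.conj_im]

lemma isMaximalDissipative_neg_inverse {T : H →ₗ.[ℂ] H} (hT : IsDissipative T)
    (hker : LinearMap.ker T.toFun = ⊥)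
    (hsurj : ∀ h, ∃ a b, (a, b) ∈ T.graph ∧ b + Complex.I • a = h) :
    IsMaximalDissipative (-T.inverse) := by
  refine isMaximalDissipative_of_surjective (hT.neg_inverse hker) fun h => ?_
  -- For `(a, b)` in the graph of `T`, the point `(b, -a)` of `-T⁻¹` satisfies `-a + i b = i (b + i
  -- a)`, hence the right-hand side `-i h`.
  obtain ⟨a, b, hab, e⟩ := hsurj (-Complex.I • h)
  refine ⟨b, -a, (mem_graph_neg_inverse hker).2 (by rwa [neg_neg]), ?_⟩
  have : Complex.I • (b + Complex.I • a) = h := by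
    rw [e, smul_smul]; simp
  rw [← this, smul_add, smul_smul, Complex.I_mul_I]
  module

lemma IsSymmetricOp.neg {T : H →ₗ.[ℂ] H} (hT : IsSymmetricOp T) : IsSymmetricOp (-T) := by
  refine ⟨hT.1, fun x y => ?_⟩
  have := hT.2 x y
  rw [LinearPMap.neg_apply, LinearPMap.neg_apply, inner_neg_left, inner_neg_right, this]

variable [CompleteSpace H]

lemma mem_graph_adjoint {T : H →ₗ.[ℂ] H} (hT : Dense (T.domain : Set H)) {x y : H} :
    (x, y) ∈ T.adjoint.graph ↔ ∀ a b, (a, b) ∈ T.graph → inner ℂ b x = inner ℂ a y := by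
  rw [LinearPMap.adjoint_graph_eq_graph_adjoint hT, Submodule.mem_adjoint_iff]
  simp only [sub_eq_zero]

lemma mem_defectSpace {T : H →ₗ.[ℂ] H} {z : ℂ} {g : H} :
    g ∈ defectSpace T z ↔ (g, z • g) ∈ T.adjoint.graph := by
  rw [LinearPMap.mem_graph_iff]
  constructor
  · rintro ⟨h, e⟩
    exact ⟨⟨g, h⟩, rfl, e⟩
  · rintro ⟨⟨u, hu⟩, rfl, e⟩
    exact ⟨hu, e⟩

lemma adjoint_anti {S T : H →ₗ.[ℂ] H} (hS : Dense (S.domain : Set H)) (h : S ≤ T) :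
    T.adjoint ≤ S.adjoint := by
  refine LinearPMap.le_of_le_graph ?_
  rintro ⟨x, y⟩ hxy
  rw [mem_graph_adjoint (hS.mono h.1)] at hxy
  exact (mem_graph_adjoint hS).2 fun a b hab => hxy a b (LinearPMap.le_graph_of_le h hab)

lemma adjoint_neg {T : H →ₗ.[ℂ] H} (hT : Dense (T.domain : Set H)) :
    (-T).adjoint = -T.adjoint := by
  refine LinearPMap.eq_of_eq_graph ?_
  ext ⟨x, y⟩
  rw [mem_graph_neg, mem_graph_adjoint (T := -T) hT, mem_graph_adjoint hT]
  constructor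
  · intro h a b hab
    have := h a (-b) (mem_graph_neg.2 (by rwa [neg_neg]))
    rw [inner_neg_left] at this
    rw [inner_neg_right, ← this, neg_neg]
  · intro h a b hab
    have := h a (-b) (mem_graph_neg.1 hab)
    rwa [inner_neg_left, inner_neg_right, neg_inj] at this

/-- The domain of `T⁻¹` is `Ran T`, whose orthogonal complement is `Ker T*`. -/
lemma dense_inverse_domain {T : H →ₗ.[ℂ] H} (hT : Dense (T.domain : Set H))
    (hker : LinearMap.ker T.toFun = ⊥) (hadj : LinearMap.ker T.adjoint.toFun = ⊥) :
    Dense (T.inverse.domain : Set H) := by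
  rw [Submodule.dense_iff_topologicalClosure_eq_top,
    Submodule.topologicalClosure_eq_top_iff, Submodule.eq_bot_iff]
  intro x hx
  refine ker_eq_bot_iff.1 hadj x ((mem_graph_adjoint hT).2 fun a b hab => ?_)
  rw [inner_zero_right]
  exact hx b (LinearPMap.mem_domain_of_mem_graph ((mem_graph_inverse hker).2 hab))

lemma adjoint_inverse {T : H →ₗ.[ℂ] H} (hT : Dense (T.domain : Set H))
    (hker : LinearMap.ker T.toFun = ⊥) (hadj : LinearMap.ker T.adjoint.toFun = ⊥) :
    T.inverse.adjoint = T.adjoint.inverse := by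
  refine LinearPMap.eq_of_eq_graph ?_
  ext ⟨x, y⟩
  rw [mem_graph_inverse hadj, mem_graph_adjoint (dense_inverse_domain hT hker hadj),
    mem_graph_adjoint hT]
  constructor
  · intro h a b hab
    exact (h b a ((mem_graph_inverse hker).2 hab)).symm
  · intro h a b hab
    exact (h b a ((mem_graph_inverse hker).1 hab)).symm

lemma IsSymmetricOp.inverse {T : H →ₗ.[ℂ] H} (hT : IsSymmetricOp T)
    (hker : LinearMap.ker T.toFun = ⊥) (hadj : LinearMap.ker T.adjoint.toFun = ⊥) :
    IsSymmetricOp T.inverse := by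
  refine ⟨dense_inverse_domain hT.1 hker hadj, isFormalAdjoint_iff.2 fun a b c d hab hcd => ?_⟩
  rw [mem_graph_inverse hker] at hab hcd
  exact (isFormalAdjoint_iff.1 hT.2 _ _ _ _ hab hcd).symm

lemma isSelfAdjoint_neg_op {A : H →ₗ.[ℂ] H} (hA : IsSelfAdjoint A) : IsSelfAdjoint (-A) := by
  have h : A.adjoint = A := hA
  change (-A).adjoint = -A
  rw [adjoint_neg hA.dense_domain, h]

lemma isSelfAdjoint_inverse {A : H →ₗ.[ℂ] H} (hA : IsSelfAdjoint A)
    (hker : LinearMap.ker A.toFun = ⊥) : IsSelfAdjoint A.inverse := by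
  have h : A.adjoint = A := hA
  change A.inverse.adjoint = A.inverse
  rw [adjoint_inverse hA.dense_domain hker (by rwa [h]), h]

/-- Serves to show that the inverse of the dissipative extension cannot be self-adjoint. -/
lemma isSelfAdjoint_of_inverse {X : H →ₗ.[ℂ] H} (hX : Dense (X.domain : Set H))
    (hker : LinearMap.ker X.toFun = ⊥) (hadj : LinearMap.ker X.adjoint.toFun = ⊥)
    (h : IsSelfAdjoint X.inverse) : IsSelfAdjoint X := by
  have h1 : X.inverse.adjoint = X.inverse := h
  rw [adjoint_inverse hX hker hadj] at h1
  change X.adjoint = X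
  refine LinearPMap.eq_of_eq_graph ?_
  ext ⟨x, y⟩
  rw [← mem_graph_inverse hadj, h1, mem_graph_inverse hker]

/-- `T* g = z g` and `(T*)⁻¹ g = z⁻¹ g` are the same relation. In particular inversion alone
exchanges the spaces at `i` and `-i`, and the minus sign exchanges them back. -/
lemma defectSpace_inverse {T : H →ₗ.[ℂ] H} (hT : Dense (T.domain : Set H))
    (hker : LinearMap.ker T.toFun = ⊥) (hadj : LinearMap.ker T.adjoint.toFun = ⊥)
    {z w : ℂ} (hzw : z * w = 1) : defectSpace T.inverse w = defectSpace T z := by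
  ext g
  rw [mem_defectSpace, mem_defectSpace, adjoint_inverse hT hker hadj, mem_graph_inverse hadj]
  constructor
  · intro h
    have := T.adjoint.graph.smul_mem z h
    rwa [Prod.smul_mk, smul_smul, hzw, one_smul] at this
  · intro h
    have := T.adjoint.graph.smul_mem w h
    rwa [Prod.smul_mk, smul_smul, mul_comm, hzw, one_smul] at this

lemma defectSpace_neg {T : H →ₗ.[ℂ] H} (hT : Dense (T.domain : Set H)) (z : ℂ) :
    defectSpace (-T) (-z) = defectSpace T z := by
  ext g
  rw [mem_defectSpace, mem_defectSpace, adjoint_neg hT, mem_graph_neg, neg_smul, neg_neg]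

lemma defectSpace_neg_inverse {T : H →ₗ.[ℂ] H} (hT : Dense (T.domain : Set H))
    (hker : LinearMap.ker T.toFun = ⊥) (hadj : LinearMap.ker T.adjoint.toFun = ⊥)
    {z w : ℂ} (hzw : z * w = -1) : defectSpace (-T.inverse) w = defectSpace T z := by
  have h := defectSpace_neg (dense_inverse_domain hT hker hadj) (-w)
  rw [neg_neg] at h
  rw [h, defectSpace_inverse hT hker hadj (z := z)]
  rw [mul_neg, hzw, neg_neg]

lemma HasDeficiencyIndices.inverse {T : H →ₗ.[ℂ] H} {m n : Cardinal}
    (h : HasDeficiencyIndices T m n) (hT : Dense (T.domain : Set H))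
    (hker : LinearMap.ker T.toFun = ⊥) (hadj : LinearMap.ker T.adjoint.toFun = ⊥) :
    HasDeficiencyIndices T.inverse n m := by
  unfold HasDeficiencyIndices
  rw [defectSpace_inverse hT hker hadj (z := -Complex.I) (by simp),
    defectSpace_inverse hT hker hadj (z := Complex.I) (by simp)]
  exact h.symm

lemma HasDeficiencyIndices.neg {T : H →ₗ.[ℂ] H} {m n : Cardinal}
    (h : HasDeficiencyIndices T m n) (hT : Dense (T.domain : Set H)) :
    HasDeficiencyIndices (-T) n m := by
  have h2 := defectSpace_neg hT (-Complex.I)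
  rw [neg_neg] at h2
  unfold HasDeficiencyIndices
  rw [defectSpace_neg hT Complex.I, h2]
  exact h.symm

lemma IsQuasiSelfAdjointExtension.inverse {T X : H →ₗ.[ℂ] H}
    (h : IsQuasiSelfAdjointExtension T X) (hT : Dense (T.domain : Set H))
    (hadj : LinearMap.ker T.adjoint.toFun = ⊥) :
    IsQuasiSelfAdjointExtension T.inverse X.inverse := by
  obtain ⟨hTX, hXT, hr⟩ := h
  have hX : Dense (X.domain : Set H) := hT.mono hTX.1
  have kX := ker_eq_bot_of_le hXT hadj
  have kT := ker_eq_bot_of_le hTX kX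
  have hX' := adjoint_anti hT hTX
  have kX' := ker_eq_bot_of_le hX' hadj
  refine ⟨inverse_mono hTX kX, ?_, ?_⟩
  · rw [adjoint_inverse hT kT hadj]
    exact inverse_mono hXT hadj
  · rw [adjoint_inverse hX kX kX']
    refine LinearPMap.eq_of_eq_graph ?_
    ext ⟨x, y⟩
    rw [mem_graph_domRestrict, mem_graph_inverse kX, mem_graph_inverse kT, ← hr,
      mem_graph_domRestrict]
    -- Here `X y = x`, and `X`, `X*` are both restrictions of `T*`. If `x = X* u`, injectivity of
    -- `T*` gives `u = y`; if `y ∈ Dom X*`, then `X* y = T* y = x`. So `x ∈ Ran X*` is the same as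
    -- `y ∈ Dom X*`.
    refine and_congr_left fun hyx => ?_
    rw [LinearPMap.mem_domain_iff, LinearPMap.mem_domain_iff]
    constructor
    · rintro ⟨u, hu⟩
      rw [mem_graph_inverse kX'] at hu
      have h1 := T.adjoint.graph.sub_mem (LinearPMap.le_graph_of_le hXT hyx)
        (LinearPMap.le_graph_of_le hX' hu)
      rw [Prod.mk_sub_mk, sub_self] at h1
      have h2 := ker_eq_bot_iff.1 hadj _ h1
      rw [sub_eq_zero.1 h2]
      exact ⟨x, hu⟩
    · rintro ⟨u, hu⟩
      refine ⟨y, (mem_graph_inverse kX').2 ?_⟩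
      have h1 := T.adjoint.graph.sub_mem (LinearPMap.le_graph_of_le hXT hyx)
        (LinearPMap.le_graph_of_le hX' hu)
      rw [Prod.mk_sub_mk, sub_self] at h1
      have h2 := LinearPMap.graph_fst_eq_zero_snd _ h1 rfl
      rwa [sub_eq_zero.1 h2]

end Graph

/-! ### Transfer of deficiency pairs, Livšic, Weyl–Titchmarsh and characteristic functions to the
negative inverses. -/

section Transfer

variable {H : Type*} [NormedAddCommGroup H] [InnerProductSpace ℂ H] [CompleteSpace H]

/-- `A₀ ⊂ A ⊂ A₀*` with `A₀` densely defined and `A₀*` injective; then `A₀`, `A` are injective. -/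
structure IsInvertiblePair (A₀ A : H →ₗ.[ℂ] H) : Prop where
  dense : Dense (A₀.domain : Set H)
  le : A₀ ≤ A
  le_adjoint : A ≤ A₀.adjoint
  ker_adjoint : LinearMap.ker A₀.adjoint.toFun = ⊥

namespace IsInvertiblePair

variable {A₀ A : H →ₗ.[ℂ] H}

lemma ker_right (h : IsInvertiblePair A₀ A) : LinearMap.ker A.toFun = ⊥ :=
  ker_eq_bot_of_le h.le_adjoint h.ker_adjoint

lemma ker_left (h : IsInvertiblePair A₀ A) : LinearMap.ker A₀.toFun = ⊥ :=
  ker_eq_bot_of_le h.le h.ker_right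

lemma defectSpace_eq (h : IsInvertiblePair A₀ A) {z w : ℂ} (hzw : z * w = -1) :
    defectSpace (-A₀.inverse) w = defectSpace A₀ z :=
  defectSpace_neg_inverse h.dense h.ker_left h.ker_adjoint hzw

lemma defectSpace_eq_neg_one_div (h : IsInvertiblePair A₀ A) {w : ℂ} (hw : 0 < w.im) :
    defectSpace (-A₀.inverse) w = defectSpace A₀ (-1 / w) := by
  refine h.defectSpace_eq ?_
  have : w ≠ 0 := by rintro rfl; simp at hw
  field_simp

/-- If `A₀* u = v`, then a multiple of `v` lies in `Ran A` exactly when `u` lies in `Dom A`. -/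
lemma mem_domain_neg_inverse (h : IsInvertiblePair A₀ A) {u v : H}
    (huv : (u, v) ∈ A₀.adjoint.graph) (c : ℂ) (hc : c ≠ 0) :
    c • v ∈ (-A.inverse).domain ↔ u ∈ A.domain := by
  constructor
  · intro hv
    obtain ⟨y, hy⟩ := LinearPMap.mem_domain_iff.1 hv
    rw [mem_graph_neg_inverse h.ker_right] at hy
    have h1 := A₀.adjoint.graph.sub_mem (A₀.adjoint.graph.smul_mem c huv)
      (LinearPMap.le_graph_of_le h.le_adjoint hy)
    rw [Prod.smul_mk, Prod.mk_sub_mk, sub_self] at h1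
    have h2 := ker_eq_bot_iff.1 h.ker_adjoint _ h1
    have h3 : c • u ∈ A.domain := by
      rw [sub_eq_zero.1 h2]
      exact LinearPMap.mem_domain_of_mem_graph hy
    rwa [Submodule.smul_mem_iff _ hc] at h3
  · intro hu
    obtain ⟨y, hy⟩ := LinearPMap.mem_domain_iff.1 hu
    have h1 := LinearPMap.mem_graph_snd_inj _ (LinearPMap.le_graph_of_le h.le_adjoint hy) huv rfl
    rw [← h1]
    refine LinearPMap.mem_domain_of_mem_graph (y := -(c • u))
      ((mem_graph_neg_inverse h.ker_right).2 ?_)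
    rw [neg_neg]
    exact A.graph.smul_mem c hy

/-- The sign comes from `A₀* (g₊ + g₋) = i (g₊ - g₋)`: the condition on `g₊ - g₋` in `Ran A` is the
condition on `g₊ + g₋` in `Dom A`. -/
lemma isDeficiencyPair_iff (h : IsInvertiblePair A₀ A) {gp gm : H} :
    IsDeficiencyPair (-A₀.inverse) (-A.inverse) gp gm ↔ IsDeficiencyPair A₀ A gp (-gm) := by
  have h1 : defectSpace (-A₀.inverse) Complex.I = defectSpace A₀ Complex.I :=
    h.defectSpace_eq (by simp)
  have h2 : defectSpace (-A₀.inverse) (-Complex.I) = defectSpace A₀ (-Complex.I) :=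
    h.defectSpace_eq (by simp)
  have key : gp ∈ defectSpace A₀ Complex.I → gm ∈ defectSpace A₀ (-Complex.I) →
      (gp - gm ∈ (-A.inverse).domain ↔ gp - -gm ∈ A.domain) := by
    intro hp hm
    rw [mem_defectSpace] at hp hm
    have hs := A₀.adjoint.graph.add_mem hp hm
    rw [Prod.mk_add_mk] at hs
    rw [sub_neg_eq_add, ← h.mem_domain_neg_inverse hs (-Complex.I) (by simp)]
    have : -Complex.I • (Complex.I • gp + -Complex.I • gm) = gp - gm := by
      rw [smul_add, smul_smul, smul_smul]
      simp [sub_eq_add_neg]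
    rw [this]
  constructor
  · rintro ⟨a, b, c, d, e⟩
    rw [h1] at a
    rw [h2] at b
    exact ⟨a, Submodule.neg_mem _ b, c, by rwa [norm_neg], (key a b).1 e⟩
  · rintro ⟨a, b, c, d, e⟩
    have b' := Submodule.neg_mem _ b
    rw [neg_neg] at b'
    exact ⟨by rwa [h1], by rwa [h2], c, by rwa [norm_neg] at d, (key a b').2 e⟩

lemma exists_pair (h : IsInvertiblePair A₀ A) (hp : ∃ gp gm, IsDeficiencyPair A₀ A gp gm) :
    ∃ gp gm, IsDeficiencyPair (-A₀.inverse) (-A.inverse) gp gm := by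
  obtain ⟨gp, gm, hg⟩ := hp
  exact ⟨gp, -gm, h.isDeficiencyPair_iff.2 (by rwa [neg_neg])⟩

end IsInvertiblePair

lemma neg_one_div_im_pos {w : ℂ} (hw : 0 < w.im) : 0 < (-1 / w).im := by
  have h0 : w ≠ 0 := by rintro rfl; simp at hw
  have : 0 < Complex.normSq w := Complex.normSq_pos.2 h0
  rw [neg_div, one_div, Complex.neg_im, Complex.inv_im, neg_div, neg_neg]
  positivity

lemma IsLivsicFunction.neg_inverse {A₀ A : H →ₗ.[ℂ] H} {s : ℂ → ℂ}
    (hs : IsLivsicFunction A₀ A s) (h : IsInvertiblePair A₀ A) :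
    IsLivsicFunction (-A₀.inverse) (-A.inverse) (fun w => s (-1 / w)) where
  exists_pair := h.exists_pair hs.exists_pair
  exists_defect w hw := by
    rw [h.defectSpace_eq_neg_one_div hw]
    exact hs.exists_defect _ (neg_one_div_im_pos hw)
  formula gp gm hg w hw g hgw hg0 := by
    rw [h.defectSpace_eq_neg_one_div hw] at hgw
    obtain ⟨h1, h2⟩ := hs.formula gp (-gm) (h.isDeficiencyPair_iff.1 hg) _
      (neg_one_div_im_pos hw) g hgw hg0
    refine ⟨h1, ?_⟩
    rw [h2, inner_neg_left]
    have hw0 : w ≠ 0 := by rintro rfl; simp at hw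
    have hwi : w + Complex.I ≠ 0 := by
      intro e
      have := congrArg Complex.im e
      simp at this
      linarith
    -- The quotient of the next two identities is `-(w - i)/(w + i)`; this minus sign cancels the
    -- one produced by `-g₋`.
    have e1 : -1 / w - Complex.I = -Complex.I * (w - Complex.I) / w := by
      field_simp
      linear_combination (-1 : ℂ) * Complex.I_sq
    have e2 : -1 / w + Complex.I = Complex.I * (w + Complex.I) / w := by
      field_simp
      linear_combination (-1 : ℂ) * Complex.I_sq
    rw [e1, e2]
    field_simp

lemma IsWeylTitchmarshFunction.neg_inverse {A₀ A : H →ₗ.[ℂ] H} {M : ℂ → ℂ}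
    (hM : IsWeylTitchmarshFunction A₀ A M) (h : IsInvertiblePair A₀ A) :
    IsWeylTitchmarshFunction (-A₀.inverse) (-A.inverse) (fun w => M (-1 / w)) := by
  -- Take `k = -w A⁻¹ f`. Then solving `(-A⁻¹ - w) f = y` amounts to solving `(A + 1/w) k = y`, and
  -- `w (-A⁻¹ f) + f` becomes `(-1/w) A k + k`, the numerator at `-1/w`.
  have key : ∀ w : ℂ, 0 < w.im → ∀ f : (-A.inverse).domain, ∃ k : A.domain,
      (f : H) = -w⁻¹ • A k ∧ (-A.inverse) f = w⁻¹ • (k : H) ∧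
      A k - (-1 / w) • (k : H) = (-A.inverse) f - w • (f : H) := by
    intro w hw f
    have hw0 : w ≠ 0 := by rintro rfl; simp at hw
    have hf := (mem_graph_neg_inverse h.ker_right).1 ((-A.inverse).mem_graph f)
    obtain ⟨u, hu1, hu2⟩ := (LinearPMap.mem_graph_iff _).1 hf
    simp only at hu1 hu2
    have e1 : (f : H) = -w⁻¹ • A (-w • u) := by
      rw [LinearPMap.map_smul, hu2, smul_smul, neg_mul_neg, inv_mul_cancel₀ hw0, one_smul]
    have e2 : (-A.inverse) f = w⁻¹ • ((-w • u : A.domain) : H) := by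
      rw [Submodule.coe_smul, hu1, smul_smul, mul_neg, inv_mul_cancel₀ hw0, neg_smul, one_smul,
        neg_neg]
    refine ⟨-w • u, e1, e2, ?_⟩
    rw [e2, e1, smul_smul]
    have : w * -w⁻¹ = -1 := by rw [mul_neg, mul_inv_cancel₀ hw0]
    rw [this, neg_div, one_div]
    module
  refine ⟨h.exists_pair hM.exists_pair, fun w hw => ⟨fun f₁ f₂ e => ?_, fun y => ?_⟩, ?_⟩
  · have hw0 : w ≠ 0 := by rintro rfl; simp at hw
    obtain ⟨k₁, a₁, -, c₁⟩ := key w hw f₁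
    obtain ⟨k₂, a₂, -, c₂⟩ := key w hw f₂
    have : k₁ = k₂ := (hM.bijective _ (neg_one_div_im_pos hw)).1 (by
      simp only at e ⊢
      rw [c₁, c₂, e])
    exact Subtype.ext (by rw [a₁, a₂, this])
  · have hw0 : w ≠ 0 := by rintro rfl; simp at hw
    obtain ⟨k, hk⟩ := (hM.bijective _ (neg_one_div_im_pos hw)).2 y
    have hg : (-w⁻¹ • A k, w⁻¹ • (k : H)) ∈ (-A.inverse).graph := by
      rw [mem_graph_neg_inverse h.ker_right, ← neg_smul]
      exact A.graph.smul_mem _ (A.mem_graph k)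
    obtain ⟨f, hf1, hf2⟩ := (LinearPMap.mem_graph_iff _).1 hg
    simp only at hf1 hf2 hk
    refine ⟨f, ?_⟩
    simp only
    have : w * -w⁻¹ = -1 := by rw [mul_neg, mul_inv_cancel₀ hw0]
    rw [hf1, hf2, ← hk, smul_smul, this, neg_div, one_div]
    module
  · intro gp gm hg w hw f hf
    obtain ⟨k, a, b, c⟩ := key w hw f
    rw [hf] at c
    have hw0 : w ≠ 0 := by rintro rfl; simp at hw
    rw [hM.formula gp (-gm) (h.isDeficiencyPair_iff.1 hg) _ (neg_one_div_im_pos hw) k c, a, b,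
      smul_smul, mul_inv_cancel₀ hw0, one_smul, neg_div, one_div, add_comm]

lemma isVonNeumannParameter_negInverse_iff {𝔄 : OperatorTriple H}
    (h : IsInvertiblePair 𝔄.symm 𝔄.ref) (h' : IsInvertiblePair 𝔄.symm 𝔄.diss) {k : ℂ} :
    𝔄.negInverse.IsVonNeumannParameter k ↔ 𝔄.IsVonNeumannParameter k := by
  -- `A₀* (g₊ - k g₋) = i (g₊ + k g₋)`, and `(g₊, -g₋)` is the admissible pair of the inverse
  -- triple, so the same `k` appears.
  have key : ∀ gp gm, IsDeficiencyPair 𝔄.symm 𝔄.ref gp gm →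
      (gp - k • -gm ∈ (-𝔄.diss.inverse).domain ↔ gp - k • gm ∈ 𝔄.diss.domain) := by
    intro gp gm hg
    have hs := 𝔄.symm.adjoint.graph.sub_mem (mem_defectSpace.1 hg.mem_plus)
      (𝔄.symm.adjoint.graph.smul_mem k (mem_defectSpace.1 hg.mem_minus))
    rw [Prod.smul_mk, Prod.mk_sub_mk] at hs
    rw [← h'.mem_domain_neg_inverse hs (-Complex.I) (by simp)]
    have : -Complex.I • (Complex.I • gp - k • -Complex.I • gm) = gp - k • -gm := by
      rw [smul_sub, smul_smul, smul_smul, smul_smul]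
      have e : -Complex.I * k * -Complex.I = -k := by
        linear_combination k * Complex.I_sq
      rw [e]
      simp
    rw [this]
  constructor
  · rintro ⟨a, ⟨gp, gm, b⟩, c⟩
    refine ⟨a, ⟨gp, -gm, h.isDeficiencyPair_iff.1 b⟩, fun gp gm hg => (key gp gm hg).1 ?_⟩
    exact c gp (-gm) (h.isDeficiencyPair_iff.2 (by rwa [neg_neg]))
  · rintro ⟨a, b, c⟩
    refine ⟨a, h.exists_pair b, fun gp gm hg => ?_⟩
    have hg' := h.isDeficiencyPair_iff.1 hg
    have := (key gp (-gm) hg').2 (c _ _ hg')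
    rwa [neg_neg] at this

lemma OperatorTriple.IsCharacteristicFunction.negInverse {𝔄 : OperatorTriple H} {S : ℂ → ℂ}
    (hS : 𝔄.IsCharacteristicFunction S)
    (h : IsInvertiblePair 𝔄.symm 𝔄.ref) (h' : IsInvertiblePair 𝔄.symm 𝔄.diss) :
    𝔄.negInverse.IsCharacteristicFunction (fun w => S (-1 / w)) := by
  obtain ⟨s, k, hs, hk, hf⟩ := hS
  exact ⟨_, k, hs.neg_inverse h, (isVonNeumannParameter_negInverse_iff h h').2 hk,
    fun w hw => hf _ (neg_one_div_im_pos hw)⟩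

end Transfer

/-! ### The model in abstract form: a self-adjoint operator with a family of defect vectors. -/

section AbstractModel

variable {H : Type*} [NormedAddCommGroup H] [InnerProductSpace ℂ H]

lemma im_inner_self (x : H) : (inner ℂ x x).im = 0 := inner_self_im (𝕜 := ℂ) x

lemma re_inner_self (x : H) : (inner ℂ x x).re = ‖x‖ ^ 2 := inner_self_eq_norm_sq (𝕜 := ℂ) x

/-- A symmetric operator `A` with `Ran (A - zI) = H` for all non-real `z`, a family of vectors
`g z ∉ Dom A` with `g z - g w = (z - w) (A - zI)⁻¹ g w`, normalized at `±i`, and a subspace `N`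
that consists, within `Dom A`, of the vectors `f` with `(A - z̄I) f ⟂ g z`. -/
structure IsDefectModel (A : H →ₗ.[ℂ] H) (N : Submodule ℂ H) (g : ℂ → H) : Prop where
  symm : A.IsFormalAdjoint A
  surj : ∀ z : ℂ, z.im ≠ 0 → ∀ h, ∃ a b, (a, b) ∈ A.graph ∧ b - z • a = h
  sub_mem : ∀ z w : ℂ, z.im ≠ 0 → w.im ≠ 0 → (g z - g w, z • g z - w • g w) ∈ A.graph
  not_mem : ∀ z : ℂ, z.im ≠ 0 → g z ∉ A.domain
  mem_iff : ∀ z : ℂ, z.im ≠ 0 → ∀ a b, (a, b) ∈ A.graph →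
    (a ∈ N ↔ inner ℂ (g z) (b - starRingEnd ℂ z • a) = 0)
  norm_I : ‖g Complex.I‖ = 1
  norm_neg_I : ‖g (-Complex.I)‖ = 1

namespace IsDefectModel

variable {A : H →ₗ.[ℂ] H} {N : Submodule ℂ H} {g : ℂ → H}

lemma inner_eq (h : IsDefectModel A N g) {a b c d : H} (hab : (a, b) ∈ A.graph)
    (hcd : (c, d) ∈ A.graph) : inner ℂ b c = inner ℂ a d :=
  isFormalAdjoint_iff.1 h.symm _ _ _ _ hab hcd

lemma im_inner_eq_zero (h : IsDefectModel A N g) {a b : H} (hab : (a, b) ∈ A.graph) :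
    (inner ℂ a b).im = 0 := by
  have h1 := h.inner_eq hab hab
  rw [← inner_conj_symm] at h1
  have h2 := congrArg Complex.im h1
  rw [Complex.conj_im] at h2
  linarith

lemma eq_zero_of_eigen (h : IsDefectModel A N g) {z : ℂ} (hz : z.im ≠ 0) {a : H}
    (ha : (a, z • a) ∈ A.graph) : a = 0 := by
  have h1 := h.im_inner_eq_zero ha
  rw [inner_smul_right, Complex.mul_im, im_inner_self, re_inner_self, mul_zero, zero_add] at h1
  simpa [hz] using h1

lemma injective (h : IsDefectModel A N g) {z : ℂ} (hz : z.im ≠ 0) {a b c d : H}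
    (hab : (a, b) ∈ A.graph) (hcd : (c, d) ∈ A.graph) (e : b - z • a = d - z • c) : a = c := by
  have h1 := A.graph.sub_mem hab hcd
  rw [Prod.mk_sub_mk] at h1
  have h2 : b - d = z • (a - c) := by
    rw [smul_sub, sub_eq_sub_iff_sub_eq_sub, e]
  rw [h2] at h1
  exact sub_eq_zero.1 (h.eq_zero_of_eigen hz h1)

lemma bijective (h : IsDefectModel A N g) {z : ℂ} (hz : z.im ≠ 0) :
    Function.Bijective fun f : A.domain => A f - z • (f : H) := by
  refine ⟨fun f₁ f₂ e => Subtype.ext (h.injective hz (A.mem_graph f₁) (A.mem_graph f₂) e),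
    fun y => ?_⟩
  obtain ⟨a, b, hab, e⟩ := h.surj z hz y
  obtain ⟨u, rfl, rfl⟩ := (LinearPMap.mem_graph_iff _).1 hab
  exact ⟨u, e⟩

lemma g_ne_zero (h : IsDefectModel A N g) {z : ℂ} (hz : z.im ≠ 0) : g z ≠ 0 := by
  intro e
  refine h.not_mem z hz ?_
  rw [e]
  exact A.domain.zero_mem

lemma inner_shift (h : IsDefectModel A N g) (z : ℂ) {a b c d : H}
    (hab : (a, b) ∈ A.graph) (hcd : (c, d) ∈ A.graph) :
    inner ℂ (b - z • a) c = inner ℂ a (d - starRingEnd ℂ z • c) := by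
  rw [inner_sub_left, inner_sub_right, h.inner_eq hab hcd, inner_smul_left, inner_smul_right]

/-- The symmetric operator of the model is the restriction of `A` to `N`. -/
lemma mem_graph_symm (h : IsDefectModel A N g) {z : ℂ} (hz : z.im ≠ 0) {a b : H} :
    (a, b) ∈ (A.domRestrict N).graph ↔
      (a, b) ∈ A.graph ∧ inner ℂ (g z) (b - starRingEnd ℂ z • a) = 0 := by
  rw [mem_graph_domRestrict, and_comm]
  exact and_congr_right fun hab => h.mem_iff z hz a b hab

/-- Together with `mem_graph_symm` this says that the range of `A₀ - z̄` is the whole orthogonal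
complement of `g z`. -/
lemma exists_symm (h : IsDefectModel A N g) {z : ℂ} (hz : z.im ≠ 0) {y : H}
    (hy : inner ℂ (g z) y = 0) :
    ∃ a b, (a, b) ∈ (A.domRestrict N).graph ∧ b - starRingEnd ℂ z • a = y := by
  obtain ⟨a, b, hab, e⟩ := h.surj (starRingEnd ℂ z) (by simpa using hz) y
  exact ⟨a, b, (h.mem_graph_symm hz).2 ⟨hab, by rw [e, hy]⟩, e⟩

lemma symm_le (_h : IsDefectModel A N g) : A.domRestrict N ≤ A := LinearPMap.domRestrict_le

lemma formal (h : IsDefectModel A N g) :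
    (A.domRestrict N).IsFormalAdjoint (A.domRestrict N) := by
  refine isFormalAdjoint_iff.2 fun a b c d hab hcd => ?_
  exact h.inner_eq (LinearPMap.le_graph_of_le h.symm_le hab)
    (LinearPMap.le_graph_of_le h.symm_le hcd)

/-- A one-dimensional subspace equals its double orthogonal complement. -/
lemma mem_span_of_orthogonal {x u : H} (hu : ∀ y, inner ℂ x y = 0 → inner ℂ u y = 0) :
    ∃ c : ℂ, u = c • x := by
  have h1 : u ∈ (Submodule.span ℂ {x})ᗮᗮ := by
    intro y hy
    rw [Submodule.mem_orthogonal_singleton_iff_inner_right] at hy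
    exact inner_eq_zero_symm.1 (hu y hy)
  rw [Submodule.orthogonal_orthogonal] at h1
  obtain ⟨c, hc⟩ := Submodule.mem_span_singleton.1 h1
  exact ⟨c, hc.symm⟩

/-- With `b = A a`, the imaginary part equals `Im z (‖a‖² + ‖b‖²)`, because `(A a, a)` is real. For
`b - z a = g i` this is `Im M(z) ≥ 0`. -/
lemma im_weyl_nonneg (h : IsDefectModel A N g) {z : ℂ} (hz : 0 < z.im) {a b : H}
    (hab : (a, b) ∈ A.graph) : 0 ≤ (inner ℂ (b - z • a) (z • b + a)).im := by
  have h1 := h.im_inner_eq_zero hab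
  have h2 := h.inner_eq hab hab
  have h3 : inner ℂ (b - z • a) (z • b + a) =
      z * inner ℂ b b - starRingEnd ℂ z * inner ℂ a a
        + (1 - starRingEnd ℂ z * z) * inner ℂ a b := by
    simp only [inner_sub_left, inner_add_right, inner_smul_left, inner_smul_right, h2]
    ring
  have h4 : (1 - starRingEnd ℂ z * z).im = 0 := by
    simp only [Complex.sub_im, Complex.one_im, Complex.mul_im, Complex.conj_re, Complex.conj_im]
    ring
  rw [h3, Complex.add_im, Complex.sub_im, Complex.mul_im, Complex.mul_im, Complex.mul_im, h1, h4,
    im_inner_self, im_inner_self, re_inner_self, re_inner_self, Complex.conj_im]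
  nlinarith [mul_nonneg hz.le (sq_nonneg ‖b‖), mul_nonneg hz.le (sq_nonneg ‖a‖)]

/-- That is, `g z = (A - i)(A - z)⁻¹ g i`, obtained from `g z - g i = (z - i)(A - z)⁻¹ g i`. -/
lemma g_eq_of_resolvent (h : IsDefectModel A N g) {z : ℂ} (hz : z.im ≠ 0) {a b : H}
    (hab : (a, b) ∈ A.graph) (e : b - z • a = g Complex.I) : g z = b - Complex.I • a := by
  have h1 := A.graph.smul_mem (z - Complex.I) hab
  rw [Prod.smul_mk] at h1
  have h2 : g z - g Complex.I = (z - Complex.I) • a := by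
    refine h.injective hz (h.sub_mem z Complex.I hz (by simp)) h1 ?_
    have h3 : (z - Complex.I) • b - z • (z - Complex.I) • a = (z - Complex.I) • g Complex.I := by
      rw [← e]; module
    rw [h3]
    module
  rw [← sub_add_cancel (g z) (g Complex.I), h2, ← e]
  module

/-- Reads `(z + i)(g z, g i) = M(z) + i`, from `(z + i)(A - i) = (zA + 1) + i (A - z)`. Dividing the
companion identity for `g (-i)` by it yields `s = (M - i)/(M + i)`. -/
lemma mul_inner_plus (h : IsDefectModel A N g) {z : ℂ} (hz : z.im ≠ 0) {a b : H}
    (hab : (a, b) ∈ A.graph) (e : b - z • a = g Complex.I) :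
    (z + Complex.I) * inner ℂ (g Complex.I) (g z) =
      inner ℂ (g Complex.I) (z • b + a) + Complex.I := by
  have h1 : (inner ℂ (g Complex.I) (g Complex.I)) = 1 := by
    rw [inner_self_eq_norm_sq_to_K, h.norm_I]; simp
  have h2 : (z + Complex.I) • g z = (z • b + a) + Complex.I • g Complex.I := by
    have h3 : (z + Complex.I) • g z = z • b + (-(Complex.I * Complex.I)) • a
        + Complex.I • (b - z • a) := by
      rw [h.g_eq_of_resolvent hz hab e]; module
    rw [h3, e, Complex.I_mul_I, neg_neg, one_smul]
  rw [← inner_smul_right, h2, inner_add_right, inner_smul_right, h1, mul_one]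

lemma mul_inner_minus (h : IsDefectModel A N g) {z : ℂ} (hz : z.im ≠ 0) {a b : H}
    (hab : (a, b) ∈ A.graph) (e : b - z • a = g Complex.I) :
    (z - Complex.I) * inner ℂ (g (-Complex.I)) (g z) =
      inner ℂ (g Complex.I) (z • b + a) - Complex.I := by
  have h1 : (inner ℂ (g Complex.I) (g Complex.I)) = 1 := by
    rw [inner_self_eq_norm_sq_to_K, h.norm_I]; simp
  -- Moves `A + i` across the inner product, using `(A + i)(g i - g (-i)) = 2i g i`. Then `(z - i)(A
  -- + i) = (zA + 1) - i (A - z)` finishes.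
  have h0 : inner ℂ (g (-Complex.I)) (g z) = inner ℂ (g Complex.I) (b + Complex.I • a) := by
    have h2 := h.inner_shift (-Complex.I)
      (h.sub_mem Complex.I (-Complex.I) (by simp) (by simp)) hab
    have h3 : (Complex.I • g Complex.I - -Complex.I • g (-Complex.I)) -
        -Complex.I • (g Complex.I - g (-Complex.I)) = (2 * Complex.I) • g Complex.I := by module
    have h5 : starRingEnd ℂ (-Complex.I) = Complex.I := by simp
    rw [h3, h5, ← h.g_eq_of_resolvent hz hab e, inner_sub_left, inner_smul_left] at h2
    have h4 : inner ℂ (g Complex.I) (g z) = inner ℂ (g Complex.I) b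
        - Complex.I * inner ℂ (g Complex.I) a := by
      rw [h.g_eq_of_resolvent hz hab e, inner_sub_right, inner_smul_right]
    have h6 : starRingEnd ℂ (2 * Complex.I) = -(2 * Complex.I) := by
      rw [map_mul, map_ofNat, Complex.conj_I, mul_neg]
    rw [h6] at h2
    rw [inner_add_right, inner_smul_right]
    linear_combination h4 + h2
  have h2 : (z - Complex.I) • (b + Complex.I • a) = (z • b + a) - Complex.I • g Complex.I := by
    have h3 : (z - Complex.I) • (b + Complex.I • a) = z • b + (-(Complex.I * Complex.I)) • a
        - Complex.I • (b - z • a) := by module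
    rw [h3, e, Complex.I_mul_I, neg_neg, one_smul]
  rw [h0, ← inner_smul_right, h2, inner_sub_right, inner_smul_right, h1, mul_one]

lemma im_inner_line (h : IsDefectModel A N g) (κ : ℂ) :
    (inner ℂ (g Complex.I - κ • g (-Complex.I))
      (Complex.I • (g Complex.I + κ • g (-Complex.I)))).im = 1 - ‖κ‖ ^ 2 := by
  have h1 : (inner ℂ (g Complex.I) (g Complex.I)) = 1 := by
    rw [inner_self_eq_norm_sq_to_K, h.norm_I]; simp
  have h2 : (inner ℂ (g (-Complex.I)) (g (-Complex.I))) = 1 := by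
    rw [inner_self_eq_norm_sq_to_K, h.norm_neg_I]; simp
  have h3 : inner ℂ (g (-Complex.I)) (g Complex.I) =
      starRingEnd ℂ (inner ℂ (g Complex.I) (g (-Complex.I))) := (inner_conj_symm _ _).symm
  rw [Complex.sq_norm, Complex.normSq_apply]
  simp only [inner_sub_left, inner_add_right, inner_smul_left, inner_smul_right, h1, h2, h3]
  simp only [Complex.mul_im, Complex.mul_re, Complex.sub_re, Complex.sub_im, Complex.add_re,
    Complex.add_im, Complex.I_re, Complex.I_im, Complex.conj_re, Complex.conj_im, Complex.one_re,
    Complex.one_im]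
  ring

variable [CompleteSpace H]

lemma dense_symm (h : IsDefectModel A N g) : Dense ((A.domRestrict N).domain : Set H) := by
  rw [Submodule.dense_iff_topologicalClosure_eq_top,
    Submodule.topologicalClosure_eq_top_iff, Submodule.eq_bot_iff]
  intro u hu
  have hi : (-Complex.I).im ≠ 0 := by simp
  obtain ⟨v, w, hvw, e⟩ := h.surj (-Complex.I) hi u
  -- With `u = (A + i) v`, orthogonality of `u` to `Dom A₀` says that `v` is orthogonal to `Ran (A₀
  -- - i)`, the complement of `g (-i)`. Since `v ∈ Dom A` and `g (-i) ∉ Dom A`, the coefficient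
  -- vanishes.
  obtain ⟨c, hc⟩ : ∃ c : ℂ, v = c • g (-Complex.I) := by
    refine mem_span_of_orthogonal fun y hy => ?_
    obtain ⟨a, b, hab, e'⟩ := h.exists_symm hi hy
    have h1 := hu a (LinearPMap.mem_domain_of_mem_graph hab)
    rw [← e', ← h.inner_shift _ hvw (LinearPMap.le_graph_of_le h.symm_le hab), e]
    exact inner_eq_zero_symm.1 h1
  have hv : v = 0 := by
    by_cases hc0 : c = 0
    · rw [hc, hc0, zero_smul]
    · have h2 := LinearPMap.mem_domain_of_mem_graph hvw
      rw [hc, Submodule.smul_mem_iff _ hc0] at h2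
      exact absurd h2 (h.not_mem _ hi)
  have hw : w = 0 := LinearPMap.graph_fst_eq_zero_snd _ hvw hv
  rw [← e, hv, hw, smul_zero, sub_zero]

lemma isSymmetricOp (h : IsDefectModel A N g) : IsSymmetricOp (A.domRestrict N) :=
  ⟨h.dense_symm, h.formal⟩

lemma isSelfAdjoint (h : IsDefectModel A N g) : IsSelfAdjoint A := by
  have hd : Dense (A.domain : Set H) := h.dense_symm.mono h.symm_le.1
  change A.adjoint = A
  refine le_antisymm (LinearPMap.le_of_le_graph ?_) (h.symm.le_adjoint hd)
  rintro ⟨x, y⟩ hxy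
  have hi : Complex.I.im ≠ 0 := by simp
  obtain ⟨a, b, hab, e⟩ := h.surj Complex.I hi (y - Complex.I • x)
  rw [mem_graph_adjoint hd] at hxy
  -- `x - a` lies in `Ker (A* - i)`, hence is orthogonal to `Ran (A + i)`, which is everything.
  have hx : x = a := by
    obtain ⟨c, d, hcd, e'⟩ := h.surj (-Complex.I) (by simp) (x - a)
    have h1 : inner ℂ (d - -Complex.I • c) (x - a) = 0 := by
      have h2 := h.inner_shift (-Complex.I) hcd hab
      have h3 : inner ℂ (d - -Complex.I • c) x = inner ℂ c (y - Complex.I • x) := by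
        rw [inner_sub_left, inner_sub_right, hxy c d hcd, inner_smul_left, inner_smul_right]
        simp
      rw [inner_sub_right, h3, h2, ← e]
      simp
    rw [e', inner_self_eq_zero] at h1
    exact sub_eq_zero.1 h1
  subst hx
  rwa [← sub_left_inj.1 e]

lemma adjoint_eq (h : IsDefectModel A N g) : A.adjoint = A := h.isSelfAdjoint

lemma le_adjoint (h : IsDefectModel A N g) : A ≤ (A.domRestrict N).adjoint := by
  have := adjoint_anti h.dense_symm h.symm_le
  rwa [h.adjoint_eq] at this

lemma g_mem (h : IsDefectModel A N g) {z : ℂ} (hz : z.im ≠ 0) :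
    g z ∈ defectSpace (A.domRestrict N) z := by
  rw [mem_defectSpace, mem_graph_adjoint h.dense_symm]
  intro a b hab
  have h1 := ((h.mem_graph_symm hz).1 hab).2
  rw [inner_eq_zero_symm, inner_sub_left, inner_smul_left, Complex.conj_conj, sub_eq_zero] at h1
  rw [h1, inner_smul_right]

lemma g_mem_graph (h : IsDefectModel A N g) {z : ℂ} (hz : z.im ≠ 0) :
    (g z, z • g z) ∈ (A.domRestrict N).adjoint.graph := mem_defectSpace.1 (h.g_mem hz)

lemma exists_smul_of_mem_defectSpace (h : IsDefectModel A N g) {z : ℂ} (hz : z.im ≠ 0) {u : H}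
    (hu : u ∈ defectSpace (A.domRestrict N) z) : ∃ c : ℂ, u = c • g z := by
  rw [mem_defectSpace, mem_graph_adjoint h.dense_symm] at hu
  refine mem_span_of_orthogonal fun y hy => ?_
  obtain ⟨a, b, hab, e⟩ := h.exists_symm hz hy
  rw [← e, inner_eq_zero_symm, inner_sub_left, hu a b hab, inner_smul_left, inner_smul_right,
    Complex.conj_conj, sub_self]

lemma defectSpace_eq_span (h : IsDefectModel A N g) {z : ℂ} (hz : z.im ≠ 0) :
    defectSpace (A.domRestrict N) z = Submodule.span ℂ {g z} := by
  refine le_antisymm (fun u hu => ?_) ?_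
  · obtain ⟨c, rfl⟩ := h.exists_smul_of_mem_defectSpace hz hu
    exact Submodule.smul_mem _ _ (Submodule.mem_span_singleton_self _)
  · rw [Submodule.span_singleton_le_iff_mem]
    exact h.g_mem hz

lemma rank_defectSpace (h : IsDefectModel A N g) {z : ℂ} (hz : z.im ≠ 0) :
    Module.rank ℂ (defectSpace (A.domRestrict N) z) = 1 := by
  rw [h.defectSpace_eq_span hz, rank_span_set, Cardinal.mk_singleton]
  exact LinearIndepOn.singleton (v := id) (h.g_ne_zero hz)

lemma hasDeficiencyIndices (h : IsDefectModel A N g) :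
    HasDeficiencyIndices (A.domRestrict N) 1 1 :=
  ⟨h.rank_defectSpace (by simp), h.rank_defectSpace (by simp)⟩

/-- `Dom A₀* = Dom A + span {g i}`. -/
lemma exists_decomposition (h : IsDefectModel A N g) {u v : H}
    (huv : (u, v) ∈ (A.domRestrict N).adjoint.graph) :
    ∃ (a b : H) (c : ℂ), (a, b) ∈ A.graph ∧ u = a + c • g Complex.I ∧
      v = b + c • Complex.I • g Complex.I := by
  have hi : Complex.I.im ≠ 0 := by simp
  obtain ⟨a, b, hab, e⟩ := h.surj Complex.I hi (v - Complex.I • u)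
  have h1 := Submodule.sub_mem _ huv (LinearPMap.le_graph_of_le h.le_adjoint hab)
  rw [Prod.mk_sub_mk] at h1
  have h2 : v - b = Complex.I • (u - a) := by
    rw [smul_sub, sub_eq_sub_iff_sub_eq_sub, e]
  rw [h2, ← mem_defectSpace] at h1
  obtain ⟨c, hc⟩ := h.exists_smul_of_mem_defectSpace hi h1
  refine ⟨a, b, c, hab, by rw [← hc, add_sub_cancel], ?_⟩
  rw [smul_comm c, ← hc, ← h2, add_sub_cancel]

lemma isDeficiencyPair (h : IsDefectModel A N g) :
    IsDeficiencyPair (A.domRestrict N) A (g Complex.I) (g (-Complex.I)) where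
  mem_plus := h.g_mem (by simp)
  mem_minus := h.g_mem (by simp)
  norm_plus := h.norm_I
  norm_minus := h.norm_neg_I
  sub_mem := LinearPMap.mem_domain_of_mem_graph (h.sub_mem _ _ (by simp) (by simp))

/-- All the normalized deficiency pairs are proportional to `(g i, g (-i))`. -/
lemma exists_smul_of_isDeficiencyPair (h : IsDefectModel A N g) {gp gm : H}
    (hg : IsDeficiencyPair (A.domRestrict N) A gp gm) :
    ∃ c : ℂ, ‖c‖ = 1 ∧ gp = c • g Complex.I ∧ gm = c • g (-Complex.I) := by
  obtain ⟨c, rfl⟩ := h.exists_smul_of_mem_defectSpace (by simp) hg.mem_plus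
  obtain ⟨d, rfl⟩ := h.exists_smul_of_mem_defectSpace (by simp) hg.mem_minus
  have hc : ‖c‖ = 1 := by
    have := hg.norm_plus
    rwa [norm_smul, h.norm_I, mul_one] at this
  -- Otherwise a nonzero multiple of `g (-i)` would lie in `Dom A`.
  have hcd : c - d = 0 := by
    by_contra hne
    have h1 := A.domain.sub_mem hg.sub_mem (A.domain.smul_mem c h.isDeficiencyPair.sub_mem)
    have h2 : c • g Complex.I - d • g (-Complex.I) - c • (g Complex.I - g (-Complex.I))
        = (c - d) • g (-Complex.I) := by module
    rw [h2, Submodule.smul_mem_iff _ hne] at h1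
    exact h.not_mem _ (by simp) h1
  exact ⟨c, hc, rfl, by rw [sub_eq_zero.1 hcd]⟩

/-! ### The Weyl–Titchmarsh and Livšic functions -/

lemma add_I_ne_zero {m : ℂ} (hm : 0 ≤ m.im) : m + Complex.I ≠ 0 := by
  intro e
  have := congrArg Complex.im e
  simp at this
  linarith

lemma norm_cayley_le_one {m : ℂ} (hm : 0 ≤ m.im) :
    ‖(m - Complex.I) / (m + Complex.I)‖ ≤ 1 := by
  rw [norm_div, div_le_one (norm_pos_iff.2 (add_I_ne_zero hm)),
    ← abs_of_nonneg (norm_nonneg (m - _)), ← abs_of_nonneg (norm_nonneg (m + _)), ← sq_le_sq,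
    Complex.sq_norm, Complex.sq_norm, Complex.normSq_apply, Complex.normSq_apply]
  simp
  nlinarith

/-- The Weyl–Titchmarsh function `M` of the model, and its Livšic function, the Cayley transform
of `M`. -/
lemma exists_weyl_livsic (h : IsDefectModel A N g) :
    ∃ M s : ℂ → ℂ, IsWeylTitchmarshFunction (A.domRestrict N) A M ∧
      IsLivsicFunction (A.domRestrict N) A s ∧ ∀ z : ℂ, 0 < z.im → ‖s z‖ ≤ 1 := by
  -- `p z` is the pair `((A - z)⁻¹ g i, A (A - z)⁻¹ g i)`; its value off the upper half-plane is
  -- irrelevant.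
  have hex : ∀ z : ℂ, ∃ p : H × H, 0 < z.im →
      p ∈ A.graph ∧ p.2 - z • p.1 = g Complex.I := by
    intro z
    by_cases hz : 0 < z.im
    · obtain ⟨a, b, hab, e⟩ := h.surj z hz.ne' (g Complex.I)
      exact ⟨(a, b), fun _ => ⟨hab, e⟩⟩
    · exact ⟨0, fun h => absurd h hz⟩
  choose p hp using hex
  let M : ℂ → ℂ := fun z => inner ℂ (g Complex.I) (z • (p z).2 + (p z).1)
  have hM : ∀ z : ℂ, 0 < z.im → 0 ≤ (M z).im := by
    intro z hz
    have := h.im_weyl_nonneg hz (hp z hz).1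
    rwa [(hp z hz).2] at this
  refine ⟨M, fun z => (M z - Complex.I) / (M z + Complex.I), ?_, ?_, ?_⟩
  · refine ⟨⟨_, _, h.isDeficiencyPair⟩, fun z hz => h.bijective hz.ne', ?_⟩
    intro gp gm hg z hz f hf
    obtain ⟨c, hc, rfl, rfl⟩ := h.exists_smul_of_isDeficiencyPair hg
    have h1 := A.graph.smul_mem c (hp z hz).1
    have h2 : (f : H) = c • (p z).1 := by
      refine h.injective hz.ne' (A.mem_graph f) h1 ?_
      rw [hf, ← (hp z hz).2]
      change _ = c • (p z).2 - z • c • (p z).1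
      module
    have h3 : A f = c • (p z).2 :=
      LinearPMap.mem_graph_snd_inj _ (A.mem_graph f) h1 h2
    have h4 : z • A f + (f : H) = c • (z • (p z).2 + (p z).1) := by
      rw [h2, h3]; module
    rw [h4, inner_smul_left, inner_smul_right, ← mul_assoc, Complex.conj_mul', hc, Complex.ofReal_one, one_pow,
      one_mul]
  · refine ⟨⟨_, _, h.isDeficiencyPair⟩,
      fun z hz => ⟨g z, h.g_mem hz.ne', h.g_ne_zero hz.ne'⟩, ?_⟩
    intro gp gm hg z hz u hu hu0
    obtain ⟨c, hc, rfl, rfl⟩ := h.exists_smul_of_isDeficiencyPair hg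
    obtain ⟨d, rfl⟩ := h.exists_smul_of_mem_defectSpace hz.ne' hu
    have hd : d ≠ 0 := by rintro rfl; simp at hu0
    have hc0 : starRingEnd ℂ c ≠ 0 := by
      rw [map_ne_zero]; rintro rfl; simp at hc
    have h1 := h.mul_inner_plus hz.ne' (hp z hz).1 (hp z hz).2
    have h2 := h.mul_inner_minus hz.ne' (hp z hz).1 (hp z hz).2
    have h3 := add_I_ne_zero (hM z hz)
    have h4 : inner ℂ (g Complex.I) (g z) ≠ 0 := by
      intro h5
      rw [h5, mul_zero] at h1
      exact h3 h1.symm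
    have h5 := add_I_ne_zero hz.le
    simp only [inner_smul_left, inner_smul_right]
    refine ⟨by simp [hd, hc0, h4], ?_⟩
    change (inner ℂ (g Complex.I) (z • (p z).2 + (p z).1) - Complex.I) /
      (inner ℂ (g Complex.I) (z • (p z).2 + (p z).1) + Complex.I) = _
    rw [← h1, ← h2]
    field_simp
  · exact fun z hz => norm_cayley_le_one (hM z hz)

/-! ### The dissipative extension -/

/-- The restriction of the adjoint of the symmetric operator of the model to
`Dom + span {g i - κ g (-i)}`. -/
def dissExt (A : H →ₗ.[ℂ] H) (N : Submodule ℂ H) (g : ℂ → H) (κ : ℂ) : H →ₗ.[ℂ] H :=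
  (A.domRestrict N).adjoint.domRestrict
    ((A.domRestrict N).domain ⊔ Submodule.span ℂ {g Complex.I - κ • g (-Complex.I)})

lemma symm_le_symm_adjoint (h : IsDefectModel A N g) :
    A.domRestrict N ≤ (A.domRestrict N).adjoint := h.symm_le.trans h.le_adjoint

lemma line_mem_graph (h : IsDefectModel A N g) (κ : ℂ) :
    (g Complex.I - κ • g (-Complex.I), Complex.I • (g Complex.I + κ • g (-Complex.I))) ∈
      (A.domRestrict N).adjoint.graph := by
  have h1 := Submodule.sub_mem _ (h.g_mem_graph (z := Complex.I) (by simp))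
    (Submodule.smul_mem _ κ (h.g_mem_graph (z := -Complex.I) (by simp)))
  rw [Prod.smul_mk, Prod.mk_sub_mk] at h1
  convert h1 using 2
  module

lemma mem_graph_dissExt (h : IsDefectModel A N g) {κ : ℂ} {x y : H} :
    (x, y) ∈ (dissExt A N g κ).graph ↔ ∃ (a b : H) (c : ℂ), (a, b) ∈ (A.domRestrict N).graph ∧
      x = a + c • (g Complex.I - κ • g (-Complex.I)) ∧
      y = b + c • Complex.I • (g Complex.I + κ • g (-Complex.I)) := by
  rw [dissExt, mem_graph_domRestrict, Submodule.mem_sup]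
  constructor
  · rintro ⟨⟨a, ha, v, hv, rfl⟩, hxy⟩
    obtain ⟨c, rfl⟩ := Submodule.mem_span_singleton.1 hv
    obtain ⟨b, hab⟩ := LinearPMap.mem_domain_iff.1 ha
    refine ⟨a, b, c, hab, rfl, LinearPMap.mem_graph_snd_inj _ hxy (Submodule.add_mem _
      (LinearPMap.le_graph_of_le h.symm_le_symm_adjoint hab)
      (Submodule.smul_mem _ c (h.line_mem_graph κ))) rfl⟩
  · rintro ⟨a, b, c, hab, rfl, rfl⟩
    exact ⟨⟨a, LinearPMap.mem_domain_of_mem_graph hab, _,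
      Submodule.smul_mem _ _ (Submodule.mem_span_singleton_self _), rfl⟩, Submodule.add_mem _
      (LinearPMap.le_graph_of_le h.symm_le_symm_adjoint hab)
      (Submodule.smul_mem _ c (h.line_mem_graph κ))⟩

lemma line_mem_dissExt (h : IsDefectModel A N g) (κ : ℂ) :
    (g Complex.I - κ • g (-Complex.I), Complex.I • (g Complex.I + κ • g (-Complex.I))) ∈
      (dissExt A N g κ).graph :=
  h.mem_graph_dissExt.2 ⟨0, 0, 1, Submodule.zero_mem _, by simp, by simp⟩

lemma symm_le_dissExt (h : IsDefectModel A N g) (κ : ℂ) :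
    A.domRestrict N ≤ dissExt A N g κ := by
  refine LinearPMap.le_of_le_graph ?_
  rintro ⟨x, y⟩ hxy
  exact h.mem_graph_dissExt.2 ⟨x, y, 0, hxy, by simp, by simp⟩

lemma dissExt_le (_h : IsDefectModel A N g) (κ : ℂ) :
    dissExt A N g κ ≤ (A.domRestrict N).adjoint := LinearPMap.domRestrict_le

lemma dense_dissExt (h : IsDefectModel A N g) (κ : ℂ) :
    Dense ((dissExt A N g κ).domain : Set H) := h.dense_symm.mono (h.symm_le_dissExt κ).1

/-- The symmetric part contributes a real number and the two cross terms are complex conjugates, so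
only the line contributes. All dissipativity and non-self-adjointness statements rest on this factor
`1 - |κ|²`. -/
lemma im_inner_dissExt (h : IsDefectModel A N g) {κ : ℂ} {a b : H} {c : ℂ}
    (hab : (a, b) ∈ (A.domRestrict N).graph) :
    (inner ℂ (a + c • (g Complex.I - κ • g (-Complex.I)))
      (b + c • Complex.I • (g Complex.I + κ • g (-Complex.I)))).im =
      ‖c‖ ^ 2 * (1 - ‖κ‖ ^ 2) := by
  have h1 := h.im_inner_eq_zero (LinearPMap.le_graph_of_le h.symm_le hab)
  have h2 := h.im_inner_line κ
  have h3 := (mem_graph_adjoint h.dense_symm).1 (h.line_mem_graph κ) a b hab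
  generalize Complex.I • (g Complex.I + κ • g (-Complex.I)) = w' at *
  generalize g Complex.I - κ • g (-Complex.I) = w at *
  have h4 : inner ℂ w b = starRingEnd ℂ (inner ℂ a w') := by rw [← h3, inner_conj_symm]
  simp only [inner_add_left, inner_add_right, inner_smul_left, inner_smul_right, h4]
  rw [Complex.sq_norm, Complex.normSq_apply]
  simp only [Complex.mul_im, Complex.mul_re, Complex.add_im, Complex.add_re, Complex.conj_re,
    Complex.conj_im, h1, h2]
  ring

lemma isDissipative_dissExt (h : IsDefectModel A N g) {κ : ℂ} (hκ : ‖κ‖ < 1) :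
    IsDissipative (dissExt A N g κ) := by
  rw [isDissipative_iff]
  intro x y hxy
  obtain ⟨a, b, c, hab, rfl, rfl⟩ := h.mem_graph_dissExt.1 hxy
  rw [h.im_inner_dissExt hab]
  have : 0 ≤ 1 - ‖κ‖ ^ 2 := by nlinarith [norm_nonneg κ]
  positivity

/-- `Ran (A₀ + i)` is the complement of `g i`, and `A₀* + i` sends `g i - κ g (-i)` to `2i g i`,
which supplies the missing direction and the coefficient `(y, g i)/(2i)`. -/
lemma surjective_dissExt (h : IsDefectModel A N g) (κ : ℂ) (y : H) :
    ∃ a b, (a, b) ∈ (dissExt A N g κ).graph ∧ b + Complex.I • a = y := by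
  have h1 : (inner ℂ (g Complex.I) (g Complex.I)) = 1 := by
    rw [inner_self_eq_norm_sq_to_K, h.norm_I]; simp
  obtain ⟨a, b, hab, e⟩ := h.exists_symm (z := Complex.I) (by simp)
    (y := y - inner ℂ (g Complex.I) y • g Complex.I)
    (by rw [inner_sub_right, inner_smul_right, h1, mul_one, sub_self])
  refine ⟨_, _, h.mem_graph_dissExt.2
    ⟨a, b, inner ℂ (g Complex.I) y / (2 * Complex.I), hab, rfl, rfl⟩, ?_⟩
  rw [Complex.conj_I] at e
  have h2 : y = (b - -Complex.I • a) + inner ℂ (g Complex.I) y • g Complex.I := by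
    rw [e, sub_add_cancel]
  have h3 : inner ℂ (g Complex.I) y =
      (inner ℂ (g Complex.I) y / (2 * Complex.I)) * (2 * Complex.I) := by
    field_simp
  generalize inner ℂ (g Complex.I) y / (2 * Complex.I) = c at *
  rw [h3] at h2
  rw [h2]
  module

lemma isQuasiSelfAdjointExtension (h : IsDefectModel A N g) {κ : ℂ} (hκ : ‖κ‖ < 1) :
    IsQuasiSelfAdjointExtension (A.domRestrict N) (dissExt A N g κ) := by
  refine ⟨h.symm_le_dissExt κ, h.dissExt_le κ, LinearPMap.eq_of_eq_graph ?_⟩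
  ext ⟨x, y⟩
  rw [mem_graph_domRestrict]
  constructor
  · rintro ⟨hx, hxy⟩
    obtain ⟨y', hy'⟩ := LinearPMap.mem_domain_iff.1 hx
    have h1 := LinearPMap.le_graph_of_le (adjoint_anti h.dense_symm (h.symm_le_dissExt κ)) hy'
    have h2 := LinearPMap.le_graph_of_le (h.dissExt_le κ) hxy
    obtain rfl : y' = y := LinearPMap.mem_graph_snd_inj _ h1 h2 rfl
    -- On the common domain the extension and its adjoint agree, both being restrictions of `A₀*`;
    -- the form is therefore real there, which kills the component `c` along the line.
    have h3 := (mem_graph_adjoint (h.dense_dissExt κ)).1 hy' _ _ hxy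
    rw [← inner_conj_symm] at h3
    have h4 := congrArg Complex.im h3
    rw [Complex.conj_im] at h4
    obtain ⟨a, b, c, hab, rfl, rfl⟩ := h.mem_graph_dissExt.1 hxy
    rw [h.im_inner_dissExt hab] at h4
    have h5 : 0 < 1 - ‖κ‖ ^ 2 := by nlinarith [norm_nonneg κ]
    have h6 : ‖c‖ ^ 2 * (1 - ‖κ‖ ^ 2) = 0 := by linarith
    have hc : c = 0 := by simpa [h5.ne'] using h6
    simpa [hc] using hab
  · intro hxy
    have hX := LinearPMap.le_graph_of_le (h.symm_le_dissExt κ) hxy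
    refine ⟨LinearPMap.mem_domain_of_mem_graph (y := y) ?_, hX⟩
    rw [mem_graph_adjoint (h.dense_dissExt κ)]
    intro a b hab
    have h1 := (mem_graph_adjoint h.dense_symm).1
      (LinearPMap.le_graph_of_le (h.dissExt_le κ) hab) x y hxy
    rw [← inner_conj_symm, ← h1, inner_conj_symm]

lemma not_isSelfAdjoint_dissExt (h : IsDefectModel A N g) {κ : ℂ} (hκ : ‖κ‖ < 1) :
    ¬ IsSelfAdjoint (dissExt A N g κ) := by
  intro hs
  have hs' : (dissExt A N g κ).adjoint = dissExt A N g κ := hs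
  have h1 := h.line_mem_dissExt κ
  have h3 := (mem_graph_adjoint (h.dense_dissExt κ)).1 (hs'.symm ▸ h1) _ _ h1
  rw [← inner_conj_symm] at h3
  have h4 := congrArg Complex.im h3
  rw [Complex.conj_im, h.im_inner_line] at h4
  nlinarith [norm_nonneg κ]

/-- Gives uniqueness of the von Neumann parameter. Applying `A₀* + i` to a decomposition of `g (-i)`
gives `(A₀ + i) a = -2i c g i`, yet this range is orthogonal to `g i`; so `c = 0` and `g (-i)` would
lie in `Dom A`. -/
lemma g_neg_I_not_mem_dissExt (h : IsDefectModel A N g) (κ : ℂ) :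
    g (-Complex.I) ∉ (dissExt A N g κ).domain := by
  intro hm
  obtain ⟨y, hy⟩ := LinearPMap.mem_domain_iff.1 hm
  obtain rfl := LinearPMap.mem_graph_snd_inj _ (LinearPMap.le_graph_of_le (h.dissExt_le κ) hy)
    (h.g_mem_graph (z := -Complex.I) (by simp)) rfl
  obtain ⟨a, b, c, hab, e1, e2⟩ := h.mem_graph_dissExt.1 hy
  have h1 := ((h.mem_graph_symm (z := Complex.I) (by simp)).1 hab).2
  have h2 : b - starRingEnd ℂ Complex.I • a = -(2 * Complex.I * c) • g Complex.I := by
    rw [Complex.conj_I]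
    have ha : a = g (-Complex.I) - c • (g Complex.I - κ • g (-Complex.I)) :=
      eq_sub_of_add_eq e1.symm
    have hb : b = -Complex.I • g (-Complex.I)
        - c • Complex.I • (g Complex.I + κ • g (-Complex.I)) := eq_sub_of_add_eq e2.symm
    rw [hb, ha]
    module
  rw [h2, inner_smul_right, inner_self_eq_norm_sq_to_K, h.norm_I] at h1
  have hc : c = 0 := by simpa using h1
  rw [hc, zero_smul, add_zero] at e1
  refine h.not_mem (-Complex.I) (by simp) ?_
  rw [e1]
  exact LinearPMap.mem_domain_of_mem_graph (LinearPMap.le_graph_of_le h.symm_le hab)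

lemma isVonNeumannParameter_iff (h : IsDefectModel A N g) {κ : ℂ} (hκ : ‖κ‖ < 1) (k : ℂ) :
    OperatorTriple.IsVonNeumannParameter ⟨A.domRestrict N, dissExt A N g κ, A⟩ k ↔ k = κ := by
  have hmem := LinearPMap.mem_domain_of_mem_graph (h.line_mem_dissExt κ)
  constructor
  · intro hk
    by_contra hne
    have h1 := Submodule.sub_mem _ hmem (hk.mem_domain _ _ h.isDeficiencyPair)
    have h2 : g Complex.I - κ • g (-Complex.I) - (g Complex.I - k • g (-Complex.I)) =
        (k - κ) • g (-Complex.I) := by module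
    rw [h2, Submodule.smul_mem_iff _ (sub_ne_zero.2 hne)] at h1
    exact h.g_neg_I_not_mem_dissExt κ h1
  · rintro rfl
    refine ⟨hκ, ⟨_, _, h.isDeficiencyPair⟩, fun gp gm hg => ?_⟩
    obtain ⟨c, hc, rfl, rfl⟩ := h.exists_smul_of_isDeficiencyPair hg
    have h1 := Submodule.smul_mem _ c hmem
    rwa [smul_sub, smul_comm] at h1

end IsDefectModel

end AbstractModel

/-! ### Multiplication by the variable in `L²(μ)` and the kernels `1/(t - z)`. -/

section ConcreteModel

lemma ofReal_sub_ne_zero {z : ℂ} (hz : z.im ≠ 0) (t : ℝ) : (t : ℂ) - z ≠ 0 := by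
  intro e
  have := congrArg Complex.im e
  simp [hz] at this

lemma abs_im_le_norm_ofReal_sub (z : ℂ) (t : ℝ) : |z.im| ≤ ‖(t : ℂ) - z‖ := by
  have := Complex.abs_im_le_norm ((t : ℂ) - z)
  simpa using this

lemma aestronglyMeasurable_kernel (μ : Measure ℝ) (z : ℂ) :
    AEStronglyMeasurable (fun t : ℝ => 1 / ((t : ℂ) - z)) μ := by
  have : Measurable (fun t : ℝ => 1 / ((t : ℂ) - z)) := by fun_prop
  exact this.aestronglyMeasurable

lemma eLpNorm_kernel {μ : Measure ℝ} (hμ : ∫⁻ t, ENNReal.ofReal (1 / (1 + t ^ 2)) ∂μ = 1)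
    {z : ℂ} (hre : z.re = 0) (him : z.im ^ 2 = 1) :
    eLpNorm (fun t : ℝ => 1 / ((t : ℂ) - z)) 2 μ = 1 := by
  rw [eLpNorm_eq_lintegral_rpow_enorm_toReal (by simp) (by simp)]
  have h : ∀ t : ℝ, ‖1 / ((t : ℂ) - z)‖ₑ ^ (2 : ℝ≥0∞).toReal
      = ENNReal.ofReal (1 / (1 + t ^ 2)) := by
    intro t
    have h1 : ‖(t : ℂ) - z‖ ^ 2 = 1 + t ^ 2 := by
      rw [Complex.sq_norm, Complex.normSq_apply]
      simp only [Complex.sub_re, Complex.sub_im, Complex.ofReal_re, Complex.ofReal_im, hre]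
      linear_combination him
    rw [ENNReal.toReal_ofNat, ENNReal.rpow_ofNat, ← ofReal_norm,
      ← ENNReal.ofReal_pow (norm_nonneg _), norm_div, div_pow, h1]
    simp
  simp only [h, hμ]
  simp

/-- Comparison with `1/(t - i)`, which has norm one by the normalization: the quotient `1 + (z -
i)/(t - z)` is bounded by `1 + |z - i|/|Im z|`. -/
lemma memLp_kernel {μ : Measure ℝ} (hμ : ∫⁻ t, ENNReal.ofReal (1 / (1 + t ^ 2)) ∂μ = 1)
    {z : ℂ} (hz : z.im ≠ 0) : MemLp (fun t : ℝ => 1 / ((t : ℂ) - z)) 2 μ := by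
  have hI : MemLp (fun t : ℝ => 1 / ((t : ℂ) - Complex.I)) 2 μ :=
    ⟨aestronglyMeasurable_kernel μ _, by rw [eLpNorm_kernel hμ (by simp) (by simp)]; simp⟩
  refine hI.of_le_mul (c := 1 + ‖z - Complex.I‖ / |z.im|) (aestronglyMeasurable_kernel μ z)
    (Filter.Eventually.of_forall fun t => ?_)
  have h1 := ofReal_sub_ne_zero hz t
  have h2 := ofReal_sub_ne_zero (z := Complex.I) (by simp) t
  have e : 1 / ((t : ℂ) - z) =
      (1 + (z - Complex.I) / ((t : ℂ) - z)) * (1 / ((t : ℂ) - Complex.I)) := by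
    field_simp
    ring
  rw [e, norm_mul]
  refine mul_le_mul_of_nonneg_right ((norm_add_le _ _).trans ?_) (norm_nonneg _)
  rw [norm_one, norm_div]
  have h3 : 0 < |z.im| := abs_pos.2 hz
  have h4 := abs_im_le_norm_ofReal_sub z t
  gcongr

open Classical in
/-- The class of `1 / (t - z)` in `L²(ℝ; dμ)`. -/
def kernelVec (μ : Measure ℝ) (z : ℂ) : Lp ℂ 2 μ :=
  if h : MemLp (fun t : ℝ => 1 / ((t : ℂ) - z)) 2 μ then h.toLp else 0

lemma coeFn_kernelVec {μ : Measure ℝ} (hμ : ∫⁻ t, ENNReal.ofReal (1 / (1 + t ^ 2)) ∂μ = 1)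
    {z : ℂ} (hz : z.im ≠ 0) : kernelVec μ z =ᵐ[μ] fun t : ℝ => 1 / ((t : ℂ) - z) := by
  rw [kernelVec, dif_pos (memLp_kernel hμ hz)]
  exact MemLp.coeFn_toLp _

lemma norm_kernelVec {μ : Measure ℝ} (hμ : ∫⁻ t, ENNReal.ofReal (1 / (1 + t ^ 2)) ∂μ = 1)
    {z : ℂ} (hre : z.re = 0) (him : z.im ^ 2 = 1) : ‖kernelVec μ z‖ = 1 := by
  have hz : z.im ≠ 0 := by rintro e; simp [e] at him
  rw [Lp.norm_def, eLpNorm_congr_ae (coeFn_kernelVec hμ hz), eLpNorm_kernel hμ hre him]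
  simp

lemma mem_graph_mulOp {μ : Measure ℝ} {f h : Lp ℂ 2 μ} :
    (f, h) ∈ (mulOp μ).graph ↔ ∀ᵐ t ∂μ, h t = (t : ℂ) * f t := by
  rw [LinearPMap.mem_graph_iff]
  constructor
  · rintro ⟨u, rfl, rfl⟩
    exact MemLp.coeFn_toLp u.2
  · intro e
    have hf : MemLp (fun t : ℝ => (t : ℂ) * f t) 2 μ := (memLp_congr_ae e).1 (Lp.memLp h)
    refine ⟨⟨f, hf⟩, rfl, Lp.ext ?_⟩
    exact (MemLp.coeFn_toLp hf).trans (Filter.EventuallyEq.symm e)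

lemma isFormalAdjoint_mulOp (μ : Measure ℝ) : (mulOp μ).IsFormalAdjoint (mulOp μ) := by
  refine isFormalAdjoint_iff.2 fun a b c d hab hcd => ?_
  rw [mem_graph_mulOp] at hab hcd
  rw [L2.inner_def, L2.inner_def]
  refine integral_congr_ae ?_
  filter_upwards [hab, hcd] with t h1 h2
  simp only [h1, h2, RCLike.inner_apply, map_mul, Complex.conj_ofReal]
  ring

lemma surj_mulOp {μ : Measure ℝ} {z : ℂ} (hz : z.im ≠ 0) (h : Lp ℂ 2 μ) :
    ∃ a b, (a, b) ∈ (mulOp μ).graph ∧ b - z • a = h := by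
  have hm : MemLp (fun t : ℝ => 1 / ((t : ℂ) - z) * h t) 2 μ := by
    refine (Lp.memLp h).of_le_mul (c := 1 / |z.im|)
      ((aestronglyMeasurable_kernel μ z).mul (Lp.aestronglyMeasurable h))
      (Filter.Eventually.of_forall fun t => ?_)
    rw [norm_mul, norm_div, norm_one]
    have h3 : 0 < |z.im| := abs_pos.2 hz
    have h4 := abs_im_le_norm_ofReal_sub z t
    gcongr
  refine ⟨hm.toLp, h + z • hm.toLp, mem_graph_mulOp.2 ?_, by simp⟩
  filter_upwards [Lp.coeFn_add h (z • hm.toLp), Lp.coeFn_smul z hm.toLp, hm.coeFn_toLp]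
    with t h1 h2 h3
  rw [h1, Pi.add_apply, h2, Pi.smul_apply, h3, smul_eq_mul]
  have := ofReal_sub_ne_zero hz t
  field_simp
  ring

lemma kernelVec_sub_mem {μ : Measure ℝ}
    (hμ : ∫⁻ t, ENNReal.ofReal (1 / (1 + t ^ 2)) ∂μ = 1) {z w : ℂ} (hz : z.im ≠ 0)
    (hw : w.im ≠ 0) :
    (kernelVec μ z - kernelVec μ w, z • kernelVec μ z - w • kernelVec μ w) ∈ (mulOp μ).graph := by
  rw [mem_graph_mulOp]
  filter_upwards [Lp.coeFn_sub (kernelVec μ z) (kernelVec μ w),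
    Lp.coeFn_sub (z • kernelVec μ z) (w • kernelVec μ w), Lp.coeFn_smul z (kernelVec μ z),
    Lp.coeFn_smul w (kernelVec μ w), coeFn_kernelVec hμ hz, coeFn_kernelVec hμ hw]
    with t h1 h2 h3 h4 h5 h6
  rw [h1, h2, Pi.sub_apply, Pi.sub_apply, h3, h4, Pi.smul_apply, Pi.smul_apply, h5, h6,
    smul_eq_mul, smul_eq_mul]
  have := ofReal_sub_ne_zero hz t
  have := ofReal_sub_ne_zero hw t
  field_simp
  ring

lemma kernelVec_not_mem {μ : Measure ℝ} (hinf : μ Set.univ = ∞)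
    (hμ : ∫⁻ t, ENNReal.ofReal (1 / (1 + t ^ 2)) ∂μ = 1) {z : ℂ} (hz : z.im ≠ 0) :
    kernelVec μ z ∉ (mulOp μ).domain := by
  intro hm
  have h1 : MemLp (fun t : ℝ => (t : ℂ) * kernelVec μ z t) 2 μ := hm
  -- `t/(t - z) - z/(t - z) = 1`, and constants are not square-integrable for an infinite measure.
  have h2 : MemLp (fun _ : ℝ => (1 : ℂ)) 2 μ := by
    refine (memLp_congr_ae ?_).1 (h1.sub ((Lp.memLp (kernelVec μ z)).const_smul z))
    filter_upwards [coeFn_kernelVec hμ hz] with t ht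
    rw [Pi.sub_apply, Pi.smul_apply, ht, smul_eq_mul]
    have := ofReal_sub_ne_zero hz t
    field_simp
  rw [memLp_const_iff (by simp) (by simp)] at h2
  simp [hinf] at h2

/-- The factor `t - z̄` cancels the conjugate of the kernel, so the inner product is `∫ a dμ`;
integrability of `a` comes for free, as a product of two `L²` functions. -/
lemma mem_zeroMean_iff {μ : Measure ℝ} (hμ : ∫⁻ t, ENNReal.ofReal (1 / (1 + t ^ 2)) ∂μ = 1)
    {z : ℂ} (hz : z.im ≠ 0) {a b : Lp ℂ 2 μ} (hab : (a, b) ∈ (mulOp μ).graph) :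
    a ∈ zeroMean μ ↔ inner ℂ (kernelVec μ z) (b - starRingEnd ℂ z • a) = 0 := by
  have e : (fun t => inner ℂ (kernelVec μ z t) ((b - starRingEnd ℂ z • a : Lp ℂ 2 μ) t))
      =ᵐ[μ] a := by
    filter_upwards [coeFn_kernelVec hμ hz, mem_graph_mulOp.1 hab,
      Lp.coeFn_sub b (starRingEnd ℂ z • a), Lp.coeFn_smul (starRingEnd ℂ z) a] with t h1 h2 h3 h4
    rw [h1, h3, Pi.sub_apply, h4, Pi.smul_apply, h2, smul_eq_mul, RCLike.inner_apply, map_div₀,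
      map_one, map_sub, Complex.conj_ofReal]
    have := ofReal_sub_ne_zero (z := starRingEnd ℂ z) (by simpa using hz) t
    field_simp
  have hi : Integrable a μ := (integrable_congr e).1 (L2.integrable_inner _ _)
  rw [L2.inner_def, integral_congr_ae e]
  exact ⟨fun h => h.2, fun h => ⟨hi, h⟩⟩

lemma isDefectModel {μ : Measure ℝ} (hinf : μ Set.univ = ∞)
    (hμ : ∫⁻ t, ENNReal.ofReal (1 / (1 + t ^ 2)) ∂μ = 1) :
    IsDefectModel (mulOp μ) (zeroMean μ) (kernelVec μ) where
  symm := isFormalAdjoint_mulOp μ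
  surj _ hz := surj_mulOp hz
  sub_mem _ _ hz hw := kernelVec_sub_mem hμ hz hw
  not_mem _ hz := kernelVec_not_mem hinf hμ hz
  mem_iff _ hz _ _ hab := mem_zeroMean_iff hμ hz hab
  norm_I := norm_kernelVec hμ (by simp) (by simp)
  norm_neg_I := norm_kernelVec hμ (by simp) (by simp)

lemma dissOp_eq {μ : Measure ℝ} (hμ : ∫⁻ t, ENNReal.ofReal (1 / (1 + t ^ 2)) ∂μ = 1) (κ : ℂ) :
    dissOp μ κ = IsDefectModel.dissExt (mulOp μ) (zeroMean μ) (kernelVec μ) κ := by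
  have e : (kernelVec μ Complex.I - κ • kernelVec μ (-Complex.I) : Lp ℂ 2 μ) =ᵐ[μ]
      fun t : ℝ => 1 / ((t : ℂ) - Complex.I) - κ * (1 / ((t : ℂ) + Complex.I)) := by
    filter_upwards [Lp.coeFn_sub (kernelVec μ Complex.I) (κ • kernelVec μ (-Complex.I)),
      Lp.coeFn_smul κ (kernelVec μ (-Complex.I)), coeFn_kernelVec hμ (z := Complex.I) (by simp),
      coeFn_kernelVec hμ (z := -Complex.I) (by simp)] with t h1 h2 h3 h4
    rw [h1, Pi.sub_apply, h2, Pi.smul_apply, h3, h4, smul_eq_mul, sub_neg_eq_add]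
  have hset : {f : Lp ℂ 2 μ | (f : ℝ → ℂ) =ᵐ[μ]
      fun t => 1 / ((t : ℂ) - Complex.I) - κ * (1 / ((t : ℂ) + Complex.I))} =
      {kernelVec μ Complex.I - κ • kernelVec μ (-Complex.I)} := by
    ext f
    rw [Set.mem_singleton_iff]
    constructor
    · intro hf
      exact Lp.ext (Filter.EventuallyEq.trans hf e.symm)
    · rintro rfl
      exact e
  rw [dissOp, extensionLine, hset]
  rfl

lemma ker_adjoint_symmOp {μ : Measure ℝ} (hinf : μ Set.univ = ∞)
    (hμ : ∫⁻ t, ENNReal.ofReal (1 / (1 + t ^ 2)) ∂μ = 1) (h0 : (0 : ℝ) ∈ coreSpectrum μ) :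
    LinearMap.ker (symmOp μ).adjoint.toFun = ⊥ := by
  rw [ker_eq_bot_iff]
  intro u hu
  obtain ⟨a, b, c, hab, rfl, e⟩ := (isDefectModel hinf hμ).exists_decomposition hu
  have hne : ∀ᵐ t ∂μ, t ≠ 0 := by
    rw [ae_iff]
    simpa using h0.2
  -- From `t a(t) + i c/(t - i) = 0`: adding `c t/(t - i)` to `t a(t)` leaves `c (t - i)/(t - i) =
  -- c`.
  have hc : ∀ᵐ t : ℝ ∂μ, (t : ℂ) * (a + c • kernelVec μ Complex.I : Lp ℂ 2 μ) t = c := by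
    have e' : (b + c • Complex.I • kernelVec μ Complex.I : Lp ℂ 2 μ) =ᵐ[μ] 0 := by
      rw [← e]
      exact Lp.coeFn_zero _ _ _
    filter_upwards [e', Lp.coeFn_add b (c • Complex.I • kernelVec μ Complex.I),
      Lp.coeFn_smul c (Complex.I • kernelVec μ Complex.I),
      Lp.coeFn_smul Complex.I (kernelVec μ Complex.I),
      Lp.coeFn_add a (c • kernelVec μ Complex.I), Lp.coeFn_smul c (kernelVec μ Complex.I),
      coeFn_kernelVec hμ (z := Complex.I) (by simp), mem_graph_mulOp.1 hab]
      with t h1 h2 h3 h4 h5 h6 h7 h8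
    rw [h2, Pi.add_apply, h3, Pi.smul_apply, h4, Pi.smul_apply, h7, h8, Pi.zero_apply,
      smul_eq_mul, smul_eq_mul] at h1
    rw [h5, Pi.add_apply, h6, Pi.smul_apply, h7, smul_eq_mul]
    have := ofReal_sub_ne_zero (z := Complex.I) (by simp) t
    field_simp at h1 ⊢
    linear_combination h1
  generalize a + c • kernelVec μ Complex.I = u at *
  by_cases hc0 : c = 0
  · refine Lp.ext ?_
    filter_upwards [hc, hne, Lp.coeFn_zero ℂ 2 μ] with t h1 h2 h3
    rw [h3, Pi.zero_apply]
    rw [hc0] at h1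
    simpa [h2] using h1
  · exfalso
    have h1 : MemLp (fun t : ℝ => 1 / (t : ℂ)) 2 μ := by
      refine (memLp_congr_ae ?_).1 ((Lp.memLp u).const_smul c⁻¹)
      filter_upwards [hc, hne] with t h1 h2
      have h2' : (t : ℂ) ≠ 0 := by exact_mod_cast h2
      rw [Pi.smul_apply, smul_eq_mul, ← h1]
      have h3 : u t ≠ 0 := by
        intro h4
        rw [h4, mul_zero] at h1
        exact hc0 h1.symm
      field_simp
    have h2 := ((memLp_two_iff_integrable_sq_norm h1.1).1 h1).lintegral_lt_top
    have h3 := h0.1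
    simp at h2 h3
    exact h2.ne h3

end ConcreteModel

end TripleModel

end

/-! ### Assembly of the theorem. -/

open TripleModel
theorem mainTheorem2 (μ : Measure ℝ) (κ : ℂ)
    (hμ_infinite : μ Set.univ = ∞)
    (hμ_normalized : ∫⁻ t, ENNReal.ofReal (1 / (1 + t ^ 2)) ∂μ = 1)
    (hκ : ‖κ‖ < 1)
    (h0 : (0 : ℝ) ∈ coreSpectrum μ) :
    -- (i)
    (LinearMap.ker (symmOp μ).toFun = ⊥ ∧
      IsSymmetricOp (symmOp μ).inverse ∧ HasDeficiencyIndices (symmOp μ).inverse 1 1) ∧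
    -- (ii)
    (LinearMap.ker (mulOp μ).toFun = ⊥ ∧
      IsSelfAdjointExtension (symmOp μ).inverse (mulOp μ).inverse) ∧
    -- (iii)
    (LinearMap.ker (dissOp μ κ).toFun = ⊥ ∧
      IsQuasiSelfAdjointExtension (symmOp μ).inverse (dissOp μ κ).inverse) ∧
    (modelTriple μ κ).negInverse.IsRegular ∧
    -- (iv)
    ((∀ k, (modelTriple μ κ).IsVonNeumannParameter k ↔ k = κ) ∧
      (∀ k, (modelTriple μ κ).negInverse.IsVonNeumannParameter k ↔ k = κ)) ∧
    -- (v)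
    (∃ sB sC : ℂ → ℂ, IsLivsicFunction (symmOp μ) (mulOp μ) sB ∧
      IsLivsicFunction (-(symmOp μ).inverse) (-(mulOp μ).inverse) sC ∧
      ∀ z : ℂ, 0 < z.im → sC (-1 / z) = sB z) ∧
    -- (vi)
    (∃ mB mC : ℂ → ℂ, IsWeylTitchmarshFunction (symmOp μ) (mulOp μ) mB ∧
      IsWeylTitchmarshFunction (-(symmOp μ).inverse) (-(mulOp μ).inverse) mC ∧
      ∀ z : ℂ, 0 < z.im → mC (-1 / z) = mB z) ∧
    -- (vii)
    (∃ SB SC : ℂ → ℂ, (modelTriple μ κ).IsCharacteristicFunction SB ∧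
      (modelTriple μ κ).negInverse.IsCharacteristicFunction SC ∧
      ∀ z : ℂ, 0 < z.im → SC (-1 / z) = SB z) := by
  have h := isDefectModel hμ_infinite hμ_normalized
  have hX := dissOp_eq hμ_normalized κ
  have hadj := ker_adjoint_symmOp hμ_infinite hμ_normalized h0
  have hd : Dense ((symmOp μ).domain : Set (Lp ℂ 2 μ)) := h.dense_symm
  have hsymm : IsSymmetricOp (symmOp μ) := h.isSymmetricOp
  have hind : HasDeficiencyIndices (symmOp μ) 1 1 := h.hasDeficiencyIndices
  have hquasi : IsQuasiSelfAdjointExtension (symmOp μ) (dissOp μ κ) := by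
    rw [hX]
    exact h.isQuasiSelfAdjointExtension hκ
  have hpair : IsInvertiblePair (symmOp μ) (mulOp μ) := ⟨hd, h.symm_le, h.le_adjoint, hadj⟩
  have hpair' : IsInvertiblePair (symmOp μ) (dissOp μ κ) := ⟨hd, hquasi.1, hquasi.2.1, hadj⟩
  have hsa := isSelfAdjoint_inverse h.isSelfAdjoint hpair.ker_right
  have hle := inverse_mono hpair.le hpair.ker_right
  have hsymm' := hsymm.inverse hpair.ker_left hadj
  have hind' := hind.inverse hd hpair.ker_left hadj
  have hquasi' := hquasi.inverse hd hadj
  have hdiss : IsDissipative (dissOp μ κ) := by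
    rw [hX]
    exact h.isDissipative_dissExt hκ
  have hsurj : ∀ y, ∃ a b, (a, b) ∈ (dissOp μ κ).graph ∧ b + Complex.I • a = y := by
    rw [hX]
    exact h.surjective_dissExt κ
  have hvN : ∀ k, (modelTriple μ κ).IsVonNeumannParameter k ↔ k = κ := by
    intro k
    rw [modelTriple, hX]
    exact h.isVonNeumannParameter_iff hκ k
  obtain ⟨M, s, hM, hs, hs1⟩ := h.exists_weyl_livsic
  have hS : (modelTriple μ κ).IsCharacteristicFunction
      (fun z => (s z - κ) / (starRingEnd ℂ κ * s z - 1)) := by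
    refine ⟨s, κ, hs, (hvN κ).2 rfl, fun z hz => ⟨fun e => ?_, rfl⟩⟩
    -- A zero of the denominator would need `|κ| |s z| = 1`, impossible with `|κ| < 1` and `|s z| ≤
    -- 1`.
    have h1 : ‖starRingEnd ℂ κ * s z‖ = 1 := by rw [sub_eq_zero.1 e, norm_one]
    rw [norm_mul, RCLike.norm_conj] at h1
    nlinarith [hs1 z hz, norm_nonneg κ, norm_nonneg (s z)]
  have hinv : ∀ z : ℂ, 0 < z.im → -1 / (-1 / z) = z := by
    intro z hz
    have : z ≠ 0 := by rintro rfl; simp at hz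
    field_simp
  refine ⟨⟨hpair.ker_left, hsymm', hind'⟩, ⟨hpair.ker_right, hle, hsa⟩,
    ⟨hpair'.ker_right, hquasi'⟩, ?_, ⟨hvN, fun k => ?_⟩, ?_, ?_, ?_⟩
  · refine ⟨hsymm'.neg, hind'.neg hsymm'.1, neg_mono hquasi'.1,
      isMaximalDissipative_neg_inverse hdiss hpair'.ker_right hsurj, fun hcon => ?_,
      neg_mono hle, isSelfAdjoint_neg_op hsa⟩
    -- Self-adjointness of the negative inverse would pass back to the dissipative extension itself.
    have h1 : IsSelfAdjoint (dissOp μ κ).inverse := by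
      have := isSelfAdjoint_neg_op hcon
      rwa [show (modelTriple μ κ).negInverse.diss = -(dissOp μ κ).inverse from rfl,
        neg_neg] at this
    have h2 := isSelfAdjoint_of_inverse (hd.mono hquasi.1.1) hpair'.ker_right
      (ker_eq_bot_of_le (adjoint_anti hd hquasi.1) hadj) h1
    rw [hX] at h2
    exact h.not_isSelfAdjoint_dissExt hκ h2
  · rw [isVonNeumannParameter_negInverse_iff hpair hpair', hvN]
  · exact ⟨s, _, hs, hs.neg_inverse hpair, fun z hz => congrArg s (hinv z hz)⟩
  · exact ⟨M, _, hM, hM.neg_inverse hpair, fun z hz => congrArg M (hinv z hz)⟩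
  · exact ⟨_, _, hS, hS.negInverse hpair hpair',
      fun z hz => by simp only [hinv z hz]⟩
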